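/- **Model.** Let $M\ge 2$ and $N\ge 1$. Let $(\Omega,\mathcal F,\mathrm P)$ be a probability space with a filtration $(\mathcal F_t)_{t\ge 0}$, let $X_t=(X_t^1,\dots,X_t^N)\in\mathbb R_+^N$, $t\ge1$, be adapted (asset payoffs), and let $\rho_t\ge 0$, $t\ge 1$, be predictable, i.e. $\mathcal F_{t-1}$-measurable (bank returns), with $\rho_t+\sum_n X_t^n>0$ a.s. for all $t\ge 1$. For $x\in\mathbb R^N$ write $|x|=\sum_n|x^n|$ and $\|x\|=(\sum_n (x^n)^2)^{1/2}$. Let $\Delta=\{\lambda\in\mathbb R_+^{MN}:\sum_n\lambda^{m,n}\le 1\text{ for each }m\}$. A *strategy* is a sequence of $\mathcal F_{t-1}\otimes\mathcal B(\mathbb R_+^M\times\Delta^{t-1})$-measurable functions $\Lambda_t(\omega,y_0,\lambda_1,\dots,\lambda_{t-1})\in[0,1]^N$, $t\ge1$, on $\Omega\times\mathbb R_+^M\times\Delta^{t-1}$ with $\sum_n\Lambda_t^n\le 1$. Given non-random initial capitals $Y_0^m>0$ and strategies $\Lambda^1,\dots,\Lambda^M$ of the $M$ investors, the realizations are defined recursively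 by $\lambda_t^{m}(\omega)=\Lambda_t^{m}(\omega,Y_0,\lambda_1(\omega),\dots,\lambda_{t-1}(\omega))$, and the wealth of the investors by $$Y_t^m=\rho_t\Bigl(1-\sum_n\lambda_t^{m,n}\Bigr)Y_{t-1}^m+\sum_n\frac{\lambda_t^{m,n}Y_{t-1}^m}{\sum_k\lambda_t^{k,n}Y_{t-1}^k}X_t^n,\qquad t\ge1\quad(0/0=0).$$ Put $W_t=\sum_m Y_t^m$ and $r_t^m=Y_t^m/W_t$ ($r_t^m=0$ if $W_t=0$). **The strategy $\hat\Lambda$.** Let $K_t(\omega,dx)$ be a regular conditional distribution of $X_t$ (on $\mathbb R_+^N$) with respect to $\mathcal F_{t-1}$. For $c\ge0$ let $\zeta_t(\omega,c)$ be the unique solution $z\in(0,c]$ of $\int\frac{c\rho_t(\omega)}{z\rho_t(\omega)+|x|}K_t(\omega,dx)=1$ if $\int\frac{c\rho_t(\omega)}{|x|}K_t(\omega,dx)>1$ (where $0/0=0$ and $a/0=+\infty$ for $a>0$), and $\zeta_t(\omega,c)=0$ otherwise. For a history $\chi_{t-1}=(y_0,\lambda_1,\dots,\lambda_{t-1})$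 let $C_{t-1}(\omega,\chi_{t-1})$ be the total wealth $\sum_m Y_{t-1}^m(\omega)$ given by the wealth equation with initial capital $y_0$ and proportions $\lambda_1,\dots,\lambda_{t-1}$. Then $$\hat\Lambda_t^n(\omega,\chi_{t-1})=\int_{\mathbb R_+^N}\frac{x^n}{\zeta_t(\omega,C_{t-1}(\omega,\chi_{t-1}))\,\rho_t(\omega)+|x|}\,K_t(\omega,dx)\qquad(0/0=0).$$ **Theorem.** Suppose investor 1 uses the strategy $\hat\Lambda$ and the other investors use arbitrary strategies. Let $\hat\lambda_t$ be the realization of investor 1's strategy and $\tilde\lambda_t=\sum_{m\ge2}\frac{r_{t-1}^m}{1-r_{t-1}^1}\lambda_t^m$ (with $\tilde\lambda_t=0$ if $r_{t-1}^1=1$) the realization of the representative strategy of the other investors. Then the set $$\Omega'=\Bigl\{\omega:\sum_{t\ge1}\|\hat\lambda_t(\omega)-\tilde\lambda_t(\omega)\|^2=\infty\Bigr\}$$ belongs to $\mathcal F$, and $r_t^1(\omega)\to1$ a.s. on $\Omega'$. In particular, the limit $\lim_{t\to\infty}r_t^1$ exists a.s., and $\|\hat\lambda_t(\omega)-\tilde\lambda_t(\omega)\|\to0$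 a.s. on the set $\{\omega:\lim_{t\to\infty}r_t^1(\omega)<1\}$. -/

import Mathlib

open MeasureTheory ProbabilityTheory Filter Topology
open scoped NNReal ENNReal

noncomputable section

namespace AssetMarket

/-- Vectors of investment proportions of one investor: no short sales, no borrowing. -/
abbrev Proportions (N : ℕ) : Type :=
  {l : Fin N → ℝ // (∀ n, 0 ≤ l n) ∧ ∑ n, l n ≤ 1}

/-- The first `t` rounds of moves `λ_1, …, λ_t` of all `M` investors;
the entry with index `s : Fin t` is `λ_{s+1}`. -/
abbrev Moves (M N t : ℕ) : Type := Fin t → Fin M → Proportions N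

/-- A market history `(y_0, λ_1, …, λ_t)`. -/
abbrev History (M N t : ℕ) : Type := (Fin M → ℝ≥0) × Moves M N t

/-- The exogenous data: payoffs `X_t` (adapted) and bank returns `ρ_t` (predictable), `t ≥ 1`.
The entries with index `0` are never used. -/
structure Market {Ω : Type*} {mΩ : MeasurableSpace Ω} (P : Measure Ω) (ℱ : Filtration ℕ mΩ)
    (N : ℕ) where
  X : ℕ → Ω → Fin N → ℝ≥0
  ρ : ℕ → Ω → ℝ≥0
  measurable_X : ∀ t, Measurable[ℱ (t + 1)] (X (t + 1))
  measurable_ρ : ∀ t, Measurable[ℱ t] (ρ (t + 1))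
  pos : ∀ t, ∀ᵐ ω ∂P, 0 < ρ (t + 1) ω + ∑ n, X (t + 1) ω n

/-- A strategy: `act t` is the function `Λ_{t+1}(ω, y_0, λ_1, …, λ_t)`, measurable with respect to
`ℱ_t ⊗ Borel`. -/
structure Strategy {Ω : Type*} {mΩ : MeasurableSpace Ω} (ℱ : Filtration ℕ mΩ) (M N : ℕ) where
  act : (t : ℕ) → Ω → History M N t → Proportions N
  measurable_act : ∀ t,
    Measurable[(ℱ t).prod (inferInstance : MeasurableSpace (History M N t))]
      (fun p : Ω × History M N t => act t p.1 p.2)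

/-- One step of the wealth equation. The quotient is `0` when nobody invests in the asset. -/
def wealthStep {M N : ℕ} (ρ : ℝ≥0) (x : Fin N → ℝ≥0) (l : Fin M → Proportions N)
    (y : Fin M → ℝ) (m : Fin M) : ℝ :=
  ρ * (1 - ∑ n, (l m).1 n) * y m +
    ∑ n, (l m).1 n * y m / (∑ k, (l k).1 n * y k) * x n

section Model

variable {Ω : Type*} {mΩ : MeasurableSpace Ω} {P : Measure Ω} {ℱ : Filtration ℕ mΩ} {M N : ℕ}

/-- Wealth `Y_t` of the investors after the history `(y_0, λ_1, …, λ_t)`. -/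
def Market.wealthOf (S : Market P ℱ N) (ω : Ω) (y₀ : Fin M → ℝ≥0) :
    (t : ℕ) → Moves M N t → Fin M → ℝ
  | 0, _ => fun m => y₀ m
  | t + 1, χ => wealthStep (S.ρ (t + 1) ω) (S.X (t + 1) ω) (χ (Fin.last t))
      (Market.wealthOf S ω y₀ t (Fin.init χ))

/-- Total wealth `C_t(ω, χ_t)` of all investors after the history `χ_t`. -/
def Market.totalWealthOf (S : Market P ℱ N) (t : ℕ) (ω : Ω) (χ : History M N t) : ℝ :=
  ∑ m, S.wealthOf ω χ.1 t χ.2 m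

/-- The moves `λ_1(ω), …, λ_t(ω)` realized when the investors use the strategy profile `L`. -/
def realizedMoves (L : Fin M → Strategy ℱ M N) (y₀ : Fin M → ℝ≥0) (ω : Ω) :
    (t : ℕ) → Moves M N t
  | 0 => Fin.elim0
  | t + 1 => Fin.snoc (α := fun _ => Fin M → Proportions N) (realizedMoves L y₀ ω t)
      (fun m => (L m).act t ω (y₀, realizedMoves L y₀ ω t))

/-- `realization L y₀ t ω m n` is the realized proportion `λ_{t+1}^{m,n}(ω)`. -/
def realization (L : Fin M → Strategy ℱ M N) (y₀ : Fin M → ℝ≥0) (t : ℕ) (ω : Ω)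
    (m : Fin M) (n : Fin N) : ℝ :=
  ((L m).act t ω (y₀, realizedMoves L y₀ ω t)).1 n

/-- The realized wealth `Y_t^m(ω)`. -/
def Market.wealth (S : Market P ℱ N) (L : Fin M → Strategy ℱ M N) (y₀ : Fin M → ℝ≥0)
    (t : ℕ) (ω : Ω) (m : Fin M) : ℝ :=
  S.wealthOf ω y₀ t (realizedMoves L y₀ ω t) m

/-- The relative wealth `r_t^m(ω) = Y_t^m / W_t` (it is `0` if `W_t = 0`). -/
def Market.relWealth (S : Market P ℱ N) (L : Fin M → Strategy ℱ M N) (y₀ : Fin M → ℝ≥0)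
    (t : ℕ) (ω : Ω) (m : Fin M) : ℝ :=
  S.wealth L y₀ t ω m / ∑ k, S.wealth L y₀ t ω k

/-- `S.representative L y₀ i t ω n` is the component `n` of the realization at time `t + 1` of the
representative strategy of the investors other than `i`: their realized proportions weighted by
`r_t^m / (1 - r_t^i)`. It is `0` if `r_t^i = 1`. -/
def Market.representative (S : Market P ℱ N) (L : Fin M → Strategy ℱ M N) (y₀ : Fin M → ℝ≥0)
    (i : Fin M) (t : ℕ) (ω : Ω) (n : Fin N) : ℝ :=
  ∑ m ∈ Finset.univ.erase i,
    S.relWealth L y₀ t ω m / (1 - S.relWealth L y₀ t ω i) * realization L y₀ t ω m n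

/-- The Euclidean distance, at time `t + 1`, between the realization of the strategy of investor
`i` and the realization of the representative strategy of the other investors. -/
def Market.distance (S : Market P ℱ N) (L : Fin M → Strategy ℱ M N) (y₀ : Fin M → ℝ≥0)
    (i : Fin M) (t : ℕ) (ω : Ω) : ℝ :=
  ‖WithLp.toLp 2 (fun n => realization L y₀ t ω i n - S.representative L y₀ i t ω n)‖

/-- A regular conditional distribution of the payoffs: `kernel t` is the conditional distribution
`K_{t+1}` of `X_{t+1}` with respect to `ℱ_t`. -/
structure PayoffKernel (S : Market P ℱ N) where
  kernel : (t : ℕ) → Kernel[ℱ t] Ω (Fin N → ℝ≥0)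
  prob : ∀ t ω, IsProbabilityMeasure (kernel t ω)
  version : ∀ t (A : Set (Fin N → ℝ≥0)), MeasurableSet A →
    (fun ω => (kernel t ω).real A) =ᵐ[P] P⟦S.X (t + 1) ⁻¹' A | ℱ t⟧

end Model

section Zeta

variable {N : ℕ}

/-- `∫ c ρ / (z ρ + |x|) κ(dx)`. In `ℝ≥0∞` one has `0 / 0 = 0` and `a / 0 = ∞` for `a > 0`. -/
def cashIntegral (κ : Measure (Fin N → ℝ≥0)) (ρ : ℝ≥0) (c z : ℝ) : ℝ≥0∞ :=
  ∫⁻ x, ENNReal.ofReal (c * ρ) / ENNReal.ofReal (z * ρ + ∑ n, (x n : ℝ)) ∂κ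

/-- Membership of `(ω, c)` in `Γ_t`, for `κ = K_t(ω, ·)` and `ρ = ρ_t(ω)`. -/
def InGamma (κ : Measure (Fin N → ℝ≥0)) (ρ : ℝ≥0) (c : ℝ) : Prop :=
  1 < cashIntegral κ ρ c 0

theorem InGamma.pos {κ : Measure (Fin N → ℝ≥0)} {ρ : ℝ≥0} {c : ℝ} (h : InGamma κ ρ c) :
    0 < c ∧ 0 < ρ := by
  by_contra hn
  have h0 : c * ρ ≤ 0 := by
    rcases not_and_or.1 hn with hc | hr
    · exact mul_nonpos_of_nonpos_of_nonneg (not_lt.1 hc) ρ.2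
    · have : ρ = 0 := le_antisymm (not_lt.1 hr) bot_le
      simp [this]
  unfold InGamma cashIntegral at h
  simp [ENNReal.ofReal_of_nonpos h0] at h

theorem measurable_cashIntegrand (ρ : ℝ≥0) (c z : ℝ) :
    Measurable (fun x : Fin N → ℝ≥0 =>
      ENNReal.ofReal (c * ρ) / ENNReal.ofReal (z * ρ + ∑ n, (x n : ℝ))) := by
  fun_prop

theorem cashIntegral_antitone (κ : Measure (Fin N → ℝ≥0)) (ρ : ℝ≥0) (c : ℝ) :
    Antitone (cashIntegral κ ρ c) := by
  intro z w hzw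
  unfold cashIntegral
  gcongr

theorem cashIntegrand_le {ρ : ℝ≥0} (c : ℝ) {z : ℝ} (x : Fin N → ℝ≥0) :
    ENNReal.ofReal (c * ρ) / ENNReal.ofReal (z * ρ + ∑ n, (x n : ℝ)) ≤
      ENNReal.ofReal (c * ρ) / ENNReal.ofReal (z * ρ) := by
  gcongr
  have : 0 ≤ ∑ n, (x n : ℝ) := Finset.sum_nonneg fun n _ => (x n).2
  linarith

theorem bound_ne_top {ρ : ℝ≥0} (c : ℝ) {z : ℝ} (hz : 0 < z) (hρ : 0 < ρ) :
    ENNReal.ofReal (c * ρ) / ENNReal.ofReal (z * ρ) ≠ ∞ := by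
  have : 0 < z * (ρ : ℝ) := mul_pos hz (by exact_mod_cast hρ)
  exact ENNReal.div_ne_top ENNReal.ofReal_ne_top (by simpa using this)

theorem cashIntegral_ne_top (κ : Measure (Fin N → ℝ≥0)) [IsProbabilityMeasure κ] {ρ : ℝ≥0}
    (c : ℝ) {z : ℝ} (hz : 0 < z) (hρ : 0 < ρ) : cashIntegral κ ρ c z ≠ ∞ := by
  refine ne_top_of_le_ne_top (bound_ne_top c hz hρ) ?_
  calc cashIntegral κ ρ c z ≤ ∫⁻ _, ENNReal.ofReal (c * ρ) / ENNReal.ofReal (z * ρ) ∂κ :=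
        lintegral_mono fun x => cashIntegrand_le c x
    _ = _ := by simp

theorem cashIntegral_strictAnti (κ : Measure (Fin N → ℝ≥0)) [IsProbabilityMeasure κ] {ρ : ℝ≥0}
    {c z w : ℝ} (hc : 0 < c) (hρ : 0 < ρ) (hz : 0 ≤ z) (hzw : z < w) :
    cashIntegral κ ρ c w < cashIntegral κ ρ c z := by
  have hρ' : (0 : ℝ) < ρ := by exact_mod_cast hρ
  refine lintegral_strict_mono (IsProbabilityMeasure.ne_zero κ)
    (measurable_cashIntegrand ρ c z).aemeasurable
    (cashIntegral_ne_top κ c (hz.trans_lt hzw) hρ) (Eventually.of_forall fun x => ?_)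
  have hx : 0 ≤ ∑ n, (x n : ℝ) := Finset.sum_nonneg fun n _ => (x n).2
  have hlt : z * ρ + ∑ n, (x n : ℝ) < w * ρ + ∑ n, (x n : ℝ) := by
    have := mul_lt_mul_of_pos_right hzw hρ'
    linarith
  have hw : 0 < w * ρ + ∑ n, (x n : ℝ) := by
    have := mul_pos (hz.trans_lt hzw) hρ'
    linarith
  refine ENNReal.div_lt_div_left ?_ ENNReal.ofReal_ne_top ?_
  · simpa using mul_pos hc hρ'
  · exact (ENNReal.ofReal_lt_ofReal_iff hw).2 hlt

theorem tendsto_cashIntegrand {ρ : ℝ≥0} {c : ℝ} (z : ℝ) (x : Fin N → ℝ≥0) :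
    Tendsto (fun w : ℝ => ENNReal.ofReal (c * ρ) / ENNReal.ofReal (w * ρ + ∑ n, (x n : ℝ)))
      (𝓝 z) (𝓝 (ENNReal.ofReal (c * ρ) / ENNReal.ofReal (z * ρ + ∑ n, (x n : ℝ)))) := by
  refine ENNReal.Tendsto.const_div ?_ (Or.inr ENNReal.ofReal_ne_top)
  exact (ENNReal.continuous_ofReal.comp (by fun_prop)).tendsto z

theorem exists_zeta (κ : Measure (Fin N → ℝ≥0)) [IsProbabilityMeasure κ] {ρ : ℝ≥0} {c : ℝ}
    (h : InGamma κ ρ c) : ∃ z : ℝ, (0 < z ∧ z ≤ c) ∧ cashIntegral κ ρ c z = 1 := by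
  obtain ⟨hc, hρ⟩ := h.pos
  have hρ' : (0 : ℝ) < ρ := by exact_mod_cast hρ
  have hle : cashIntegral κ ρ c c ≤ 1 := by
    calc cashIntegral κ ρ c c ≤ ∫⁻ _, ENNReal.ofReal (c * ρ) / ENNReal.ofReal (c * ρ) ∂κ :=
          lintegral_mono fun x => cashIntegrand_le c x
      _ = ENNReal.ofReal (c * ρ) / ENNReal.ofReal (c * ρ) := by simp
      _ ≤ 1 := ENNReal.div_self_le_one
  obtain ⟨z₀, hz₀, h1⟩ : ∃ z₀ : ℝ, 0 < z₀ ∧ 1 < cashIntegral κ ρ c z₀ := by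
    by_contra! hcon
    have hF := lintegral_liminf_le' (μ := κ) (u := 𝓝[>] (0 : ℝ))
      (f := fun (w : ℝ) (x : Fin N → ℝ≥0) =>
        ENNReal.ofReal (c * ρ) / ENNReal.ofReal (w * ρ + ∑ n, (x n : ℝ)))
      (fun w => (measurable_cashIntegrand ρ c w).aemeasurable)
    have hlim : ∀ x : Fin N → ℝ≥0, liminf (fun w : ℝ =>
        ENNReal.ofReal (c * ρ) / ENNReal.ofReal (w * ρ + ∑ n, (x n : ℝ))) (𝓝[>] (0 : ℝ)) =
        ENNReal.ofReal (c * ρ) / ENNReal.ofReal (0 * ρ + ∑ n, (x n : ℝ)) := fun x =>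
      ((tendsto_cashIntegrand 0 x).mono_left nhdsWithin_le_nhds).liminf_eq
    simp only [hlim] at hF
    have hev : ∀ᶠ w in 𝓝[>] (0 : ℝ), cashIntegral κ ρ c w ≤ 1 := by
      filter_upwards [self_mem_nhdsWithin] with w hw using hcon w hw
    have h2 : liminf (fun w : ℝ => cashIntegral κ ρ c w) (𝓝[>] (0 : ℝ)) ≤ 1 :=
      (liminf_le_liminf hev).trans (by simp)
    exact absurd (lt_of_lt_of_le h (hF.trans h2)) (lt_irrefl _)
  have hz₀c : z₀ ≤ c := by
    by_contra! hlt
    exact absurd (h1.trans_le ((cashIntegral_antitone κ ρ c hlt.le).trans hle)) (lt_irrefl _)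
  have hcont : ContinuousOn (cashIntegral κ ρ c) (Set.Icc z₀ c) := by
    intro z hz
    have hz0 : 0 < z := hz₀.trans_le hz.1
    refine ContinuousAt.continuousWithinAt ?_
    refine tendsto_lintegral_filter_of_dominated_convergence
      (fun _ => ENNReal.ofReal (c * ρ) / ENNReal.ofReal (z / 2 * ρ))
      (Eventually.of_forall fun w => measurable_cashIntegrand ρ c w) ?_ ?_
      (Eventually.of_forall fun x => tendsto_cashIntegrand z x)
    · filter_upwards [lt_mem_nhds (half_lt_self hz0)] with w hw
      refine Eventually.of_forall fun x => (cashIntegrand_le c x).trans ?_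
      gcongr
    · simpa using bound_ne_top c (half_pos hz0) hρ
  obtain ⟨z, hz, hz1⟩ := intermediate_value_Icc' hz₀c hcont ⟨hle, h1.le⟩
  exact ⟨z, ⟨hz₀.trans_le hz.1, hz.2⟩, hz1⟩

open Classical in
/-- `ζ`: on `Γ` the (unique) solution `z ∈ (0, c]` of `∫ c ρ / (z ρ + |x|) κ(dx) = 1`, and `0`
outside `Γ`. -/
def zeta (κ : Measure (Fin N → ℝ≥0)) [IsProbabilityMeasure κ] (ρ : ℝ≥0) (c : ℝ) : ℝ :=
  if h : InGamma κ ρ c then (exists_zeta κ h).choose else 0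

theorem zeta_spec (κ : Measure (Fin N → ℝ≥0)) [IsProbabilityMeasure κ] {ρ : ℝ≥0} {c : ℝ}
    (h : InGamma κ ρ c) :
    (0 < zeta κ ρ c ∧ zeta κ ρ c ≤ c) ∧ cashIntegral κ ρ c (zeta κ ρ c) = 1 := by
  rw [zeta, dif_pos h]
  exact (exists_zeta κ h).choose_spec

theorem zeta_nonneg (κ : Measure (Fin N → ℝ≥0)) [IsProbabilityMeasure κ] (ρ : ℝ≥0) (c : ℝ) :
    0 ≤ zeta κ ρ c := by
  by_cases h : InGamma κ ρ c
  · exact (zeta_spec κ h).1.1.le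
  · rw [zeta, dif_neg h]

theorem lt_zeta_iff (κ : Measure (Fin N → ℝ≥0)) [IsProbabilityMeasure κ] (ρ : ℝ≥0) (c : ℝ)
    {a : ℝ} (ha : 0 ≤ a) : a < zeta κ ρ c ↔ 1 < cashIntegral κ ρ c a := by
  by_cases h : InGamma κ ρ c
  · obtain ⟨-, hz⟩ := zeta_spec κ h
    constructor
    · intro hlt
      rw [← hz]
      exact cashIntegral_strictAnti κ h.pos.1 h.pos.2 ha hlt
    · intro hlt
      by_contra! hle
      have := cashIntegral_antitone κ ρ c hle
      rw [hz] at this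
      exact absurd (hlt.trans_le this) (lt_irrefl _)
  · rw [zeta, dif_neg h]
    constructor
    · intro hlt
      exact absurd (hlt.trans_le ha) (lt_irrefl _)
    · intro hlt
      exact absurd (hlt.trans_le (cashIntegral_antitone κ ρ c ha)) h

theorem measurable_zeta {A : Type*} [MeasurableSpace A] (κ : Kernel A (Fin N → ℝ≥0))
    [hκ : ∀ a, IsProbabilityMeasure (κ a)] {ρ : A → ℝ≥0} (hρ : Measurable ρ) {c : A → ℝ}
    (hc : Measurable c) : Measurable (fun a => zeta (κ a) (ρ a) (c a)) := by
  have : IsMarkovKernel κ := ⟨hκ⟩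
  refine measurable_of_Ioi fun b => ?_
  rcases lt_or_ge b 0 with hb | hb
  · convert MeasurableSet.univ
    ext a
    simpa using hb.trans_le (zeta_nonneg (κ a) (ρ a) (c a))
  · have heq : (fun a => zeta (κ a) (ρ a) (c a)) ⁻¹' Set.Ioi b =
        {a | 1 < cashIntegral (κ a) (ρ a) (c a) b} := by
      ext a
      exact lt_zeta_iff (κ a) (ρ a) (c a) hb
    rw [heq]
    refine measurableSet_lt measurable_const ?_
    unfold cashIntegral
    exact Measurable.lintegral_kernel_prod_right' (κ := κ)
      (f := fun p : A × (Fin N → ℝ≥0) =>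
        ENNReal.ofReal (c p.1 * ρ p.1) / ENNReal.ofReal (b * ρ p.1 + ∑ n, (p.2 n : ℝ)))
      (by fun_prop)

end Zeta

section Optimal

variable {N : ℕ}

/-- `∫ x^n / (z ρ + |x|) κ(dx)`, with `0 / 0 = 0`. -/
def optimalShare (κ : Measure (Fin N → ℝ≥0)) (ρ : ℝ≥0) (z : ℝ) (n : Fin N) : ℝ :=
  ∫ x, (x n : ℝ) / (z * ρ + ∑ k, (x k : ℝ)) ∂κ

theorem optimalShare_nonneg (κ : Measure (Fin N → ℝ≥0)) (ρ : ℝ≥0) {z : ℝ} (hz : 0 ≤ z)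
    (n : Fin N) : 0 ≤ optimalShare κ ρ z n :=
  integral_nonneg fun x => by positivity

theorem sum_optimalShare_le (κ : Measure (Fin N → ℝ≥0)) [IsProbabilityMeasure κ] (ρ : ℝ≥0)
    {z : ℝ} (hz : 0 ≤ z) : ∑ n, optimalShare κ ρ z n ≤ 1 := by
  have hpt : ∀ x : Fin N → ℝ≥0, ∑ n, (x n : ℝ) / (z * ρ + ∑ k, (x k : ℝ)) ≤ 1 := by
    intro x
    rw [← Finset.sum_div]
    refine div_le_one_of_le₀ ?_ (by positivity)
    have : 0 ≤ z * (ρ : ℝ) := by positivity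
    linarith
  have hint : ∀ n, Integrable (fun x : Fin N → ℝ≥0 =>
      (x n : ℝ) / (z * ρ + ∑ k, (x k : ℝ))) κ := by
    intro n
    have hm : Measurable (fun x : Fin N → ℝ≥0 =>
        (x n : ℝ) / (z * ρ + ∑ k, (x k : ℝ))) := by fun_prop
    refine Integrable.of_bound (C := 1) hm.aestronglyMeasurable (Eventually.of_forall fun x => ?_)
    rw [Real.norm_of_nonneg (by positivity)]
    refine le_trans ?_ (hpt x)
    exact Finset.single_le_sum (f := fun n => (x n : ℝ) / (z * ρ + ∑ k, (x k : ℝ)))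
      (fun k _ => by positivity) (Finset.mem_univ n)
  unfold optimalShare
  rw [← integral_finsetSum _ fun n _ => hint n]
  calc _ ≤ ∫ _, (1 : ℝ) ∂κ :=
        integral_mono (integrable_finsetSum _ fun n _ => hint n) (integrable_const _) hpt
    _ = 1 := by simp

theorem measurable_optimalShare {A : Type*} [MeasurableSpace A] (κ : Kernel A (Fin N → ℝ≥0))
    [hκ : ∀ a, IsProbabilityMeasure (κ a)] {ρ : A → ℝ≥0} (hρ : Measurable ρ) {z : A → ℝ}
    (hz : Measurable z) (n : Fin N) :
    Measurable (fun a => optimalShare (κ a) (ρ a) (z a) n) := by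
  have : IsMarkovKernel κ := ⟨hκ⟩
  unfold optimalShare
  have hm : Measurable (fun p : A × (Fin N → ℝ≥0) =>
      (p.2 n : ℝ) / (z p.1 * ρ p.1 + ∑ k, (p.2 k : ℝ))) := by fun_prop
  exact (StronglyMeasurable.integral_kernel_prod_right' (κ := κ) hm.stronglyMeasurable).measurable

variable {Ω : Type*} {mΩ : MeasurableSpace Ω} {P : Measure Ω} {ℱ : Filtration ℕ mΩ} {M : ℕ}

theorem Market.measurable_wealthOf (S : Market P ℱ N) (t : ℕ) (m : Fin M) :
    Measurable[(ℱ t).prod (inferInstance : MeasurableSpace (History M N t))]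
      (fun p : Ω × History M N t => S.wealthOf p.1 p.2.1 t p.2.2 m) := by
  induction t generalizing m with
  | zero =>
    let _ : MeasurableSpace Ω := ℱ 0
    change Measurable (fun p : Ω × History M N 0 => ((p.2.1 m : ℝ≥0) : ℝ))
    fun_prop
  | succ t ih =>
    have hX := S.measurable_X t
    have hρ : Measurable[ℱ (t + 1)] (S.ρ (t + 1)) :=
      (S.measurable_ρ t).mono (ℱ.mono (Nat.le_succ t)) le_rfl
    have ih' : ∀ m : Fin M,
        Measurable[(ℱ (t + 1)).prod (inferInstance : MeasurableSpace (History M N t))]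
          (fun p : Ω × History M N t => S.wealthOf p.1 p.2.1 t p.2.2 m) := fun m =>
      (ih m).mono (sup_le_sup
        (MeasurableSpace.comap_mono (ℱ.mono (Nat.le_succ t))) le_rfl) le_rfl
    clear ih
    let _ : MeasurableSpace Ω := ℱ (t + 1)
    have hinit : Measurable (fun p : Ω × History M N (t + 1) =>
        ((p.1, (p.2.1, Fin.init p.2.2)) : Ω × History M N t)) := by
      unfold Fin.init
      fun_prop
    have hY : ∀ k : Fin M, Measurable (fun p : Ω × History M N (t + 1) =>
        S.wealthOf p.1 p.2.1 t (Fin.init p.2.2) k) := fun k => (ih' k).comp hinit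
    have hl : ∀ (k : Fin M) (n : Fin N), Measurable (fun p : Ω × History M N (t + 1) =>
        (p.2.2 (Fin.last t) k).1 n) := by
      intro k n
      exact (measurable_pi_apply n).comp (measurable_subtype_coe.comp (by fun_prop))
    simp only [Market.wealthOf, wealthStep]
    have hX' : ∀ n : Fin N, Measurable (fun p : Ω × History M N (t + 1) =>
        ((S.X (t + 1) p.1 n : ℝ≥0) : ℝ)) := by
      intro n
      exact measurable_coe_nnreal_real.comp
        ((measurable_pi_apply n).comp (hX.comp measurable_fst))
    have hρ' : Measurable (fun p : Ω × History M N (t + 1) =>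
        ((S.ρ (t + 1) p.1 : ℝ≥0) : ℝ)) :=
      measurable_coe_nnreal_real.comp (hρ.comp measurable_fst)
    refine Measurable.add ((hρ'.mul (measurable_const.sub
      (Finset.measurable_sum _ fun n _ => hl m n))).mul (hY m))
      (Finset.measurable_sum _ fun n _ => (((hl m n).mul (hY m)).div
        (Finset.measurable_sum _ fun k _ => (hl k n).mul (hY k))).mul (hX' n))

/-- `ζ_{t+1}(ω, C_t(ω, χ_t))`. -/
def optimalZeta (S : Market P ℱ N) (K : PayoffKernel S) (t : ℕ) (ω : Ω) (χ : History M N t) : ℝ :=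
  haveI := K.prob t ω
  zeta (K.kernel t ω) (S.ρ (t + 1) ω) (S.totalWealthOf t ω χ)

theorem optimalZeta_nonneg (S : Market P ℱ N) (K : PayoffKernel S) (t : ℕ) (ω : Ω)
    (χ : History M N t) : 0 ≤ optimalZeta S K t ω χ :=
  haveI := K.prob t ω
  zeta_nonneg _ _ _

/-- The strategy `Λ̂`:
`Λ̂_{t+1}^n(ω, χ_t) = ∫ x^n / (ζ_{t+1}(ω, C_t(ω, χ_t)) ρ_{t+1}(ω) + |x|) K_{t+1}(ω, dx)`. -/
def optimalStrategy (M : ℕ) (S : Market P ℱ N) (K : PayoffKernel S) : Strategy ℱ M N where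
  act t ω χ :=
    ⟨fun n => optimalShare (K.kernel t ω) (S.ρ (t + 1) ω) (optimalZeta S K t ω χ) n,
      fun n => optimalShare_nonneg _ _ (optimalZeta_nonneg S K t ω χ) n,
      haveI := K.prob t ω
      sum_optimalShare_le _ _ (optimalZeta_nonneg S K t ω χ)⟩
  measurable_act t := by
    have hρ := S.measurable_ρ t
    have hW := fun m : Fin M => S.measurable_wealthOf t m
    let _ : MeasurableSpace Ω := ℱ t
    let κ : Kernel (Ω × History M N t) (Fin N → ℝ≥0) :=
      Kernel.comap (K.kernel t) Prod.fst measurable_fst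
    have : ∀ p, IsProbabilityMeasure (κ p) := fun p => K.prob t p.1
    have hρ' : Measurable (fun p : Ω × History M N t => S.ρ (t + 1) p.1) :=
      hρ.comp measurable_fst
    have hC : Measurable (fun p : Ω × History M N t => S.totalWealthOf t p.1 p.2) :=
      Finset.measurable_sum _ fun m _ => hW m
    refine Measurable.subtype_mk (measurable_pi_iff.2 fun n => ?_)
    exact measurable_optimalShare κ hρ' (measurable_zeta κ hρ' hC) n

end Optimal

end AssetMarket

end

/-!
`-log r_t` of the optimal investor is a nonnegative supermartingale whose expected decrease in the
round `t + 1`, given the past, is at least `‖λ̂ - λ̄‖² / 4`. Here `λ̄` are the proportions of all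
investors averaged with their relative wealth, so that `λ̂ - λ̄ = (1 - r_t) (λ̂ - λ̃)`. Indeed, the
logarithmic growth of `r` is the growth of the investor's wealth minus that of the total wealth.
Jensen's inequality with the weights `x^n / (ζ ρ + |x|)` bounds the former from below, and
`log u ≤ u - 1` bounds the latter from above. In expectation, the equation defining `ζ` (with
complementary slackness where `ζ = 0`) leaves the relative entropy of `λ̂` with respect to `λ̄`, up
to the difference of their total masses, and this dominates the squared Hellinger distance.

Therefore `-log r_t` converges and the decreases are summable almost surely. Where `lim r_t < 1`,
the factors `(1 - r_t)²` are bounded away from `0`, hence `‖λ̂ - λ̃‖²` is summable.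
-/

noncomputable section

namespace AssetMarket

section LogInequalities

theorem sq_sqrt_sub_sqrt_le_mul_log {a b : ℝ} (ha : 0 ≤ a) (hb : 0 ≤ b) (hab : b = 0 → a = 0) :
    (√a - √b) ^ 2 ≤ a * Real.log (a / b) - a + b := by
  rcases ha.eq_or_lt with rfl | ha'
  · simp [Real.sq_sqrt hb]
  have hb' : 0 < b := hb.lt_of_ne fun h => ha'.ne' (hab h.symm)
  have hlog : Real.log (a / b) = -(2 * Real.log (√b / √a)) := by
    rw [← Real.sqrt_div hb, Real.log_sqrt (div_nonneg hb ha), ← inv_div b a, Real.log_inv]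
    ring
  have hle : a * Real.log (√b / √a) ≤ √a * √b - a := by
    calc a * Real.log (√b / √a) ≤ a * (√b / √a - 1) :=
          mul_le_mul_of_nonneg_left (Real.log_le_sub_one_of_pos (by positivity)) ha
      _ = √a * √b - a := by rw [mul_sub, mul_div_left_comm, Real.div_sqrt]; ring
  rw [hlog, sub_sq, Real.sq_sqrt ha, Real.sq_sqrt hb]
  linarith

theorem sq_sub_le_four_mul_sq_sqrt_sub_sqrt {a b : ℝ} (ha : a ∈ Set.Icc 0 1)
    (hb : b ∈ Set.Icc 0 1) : (a - b) ^ 2 ≤ 4 * (√a - √b) ^ 2 := by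
  have hsum : (√a + √b) ^ 2 ≤ 2 ^ 2 := by
    gcongr
    linarith [Real.sqrt_le_one.2 ha.2, Real.sqrt_le_one.2 hb.2]
  calc (a - b) ^ 2 = (√a + √b) ^ 2 * (√a - √b) ^ 2 := by
        rw [← mul_pow, ← sq_sub_sq, Real.sq_sqrt ha.1, Real.sq_sqrt hb.1]
    _ ≤ 4 * (√a - √b) ^ 2 := by
        gcongr
        linarith

variable {ι : Type*} [Fintype ι]

theorem sum_sq_sub_div_four_le_sum_mul_log {a b : ι → ℝ} (ha : ∀ n, a n ∈ Set.Icc 0 1)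
    (hb : ∀ n, b n ∈ Set.Icc 0 1) (hab : ∀ n, b n = 0 → a n = 0) :
    ∑ n, (a n - b n) ^ 2 / 4 ≤ ∑ n, a n * Real.log (a n / b n) - (∑ n, a n - ∑ n, b n) := by
  rw [← Finset.sum_sub_distrib, ← Finset.sum_sub_distrib]
  refine Finset.sum_le_sum fun n _ => ?_
  linarith [sq_sub_le_four_mul_sq_sqrt_sub_sqrt (ha n) (hb n),
    sq_sqrt_sub_sqrt_le_mul_log (ha n).1 (hb n).1 (hab n)]

-- Jensen's inequality, the missing mass `1 - ∑ n, w n` being put at the point `1`.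
theorem sum_mul_log_le_log_one_add {w z : ι → ℝ} (hw : ∀ n, 0 ≤ w n) (hw₁ : ∑ n, w n ≤ 1)
    (hz : ∀ n, 0 ≤ z n) (hwz : ∀ n, z n = 0 → w n = 0) :
    ∑ n, w n * Real.log (z n) ≤ Real.log (1 + ∑ n, w n * (z n - 1)) := by
  have hjensen := strictConcaveOn_log_Ioi.concaveOn.le_map_sum (t := Finset.univ)
    (w := fun k : Option ι => k.elim (1 - ∑ n, w n) w)
    (p := fun k => k.elim 1 fun n => if z n = 0 then 1 else z n)
    (by rintro (_ | n) - <;> simp [hw, hw₁])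
    (by simp [Fintype.sum_option])
    (by
      rintro (_ | n) -
      · simp
      · by_cases h : z n = 0
        · simp [h]
        · simpa [h] using (hz n).lt_of_ne' h)
  have hlog : ∀ n, w n * Real.log (if z n = 0 then 1 else z n) = w n * Real.log (z n) := by
    intro n
    split_ifs with h <;> simp [h]
  have hmul : ∀ n, w n * (if z n = 0 then 1 else z n) = w n * z n := by
    intro n
    split_ifs with h <;> simp [h, hwz]
  simp only [Fintype.sum_option, Option.elim, smul_eq_mul, Real.log_one, mul_zero, zero_add,
    mul_one, hlog, hmul] at hjensen
  have hsum : 1 + ∑ n, w n * (z n - 1) = 1 - ∑ n, w n + ∑ n, w n * z n := by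
    simp only [mul_sub, mul_one, Finset.sum_sub_distrib]
    ring
  rwa [hsum]

end LogInequalities

section Zeta

variable {N : ℕ}

/-- The total wealth `z ρ + |x|` of a market whose investors hold the amount `z` in the bank and
all of whose assets are owned. -/
def poolWealth (ρ : ℝ≥0) (z : ℝ) (x : Fin N → ℝ≥0) : ℝ :=
  z * ρ + ∑ n, (x n : ℝ)

@[fun_prop]
theorem measurable_poolWealth (ρ : ℝ≥0) (z : ℝ) :
    Measurable (poolWealth ρ z : (Fin N → ℝ≥0) → ℝ) := by
  unfold poolWealth
  fun_prop

theorem poolWealth_nonneg (ρ : ℝ≥0) {z : ℝ} (hz : 0 ≤ z) (x : Fin N → ℝ≥0) :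
    0 ≤ poolWealth ρ z x := by
  unfold poolWealth
  positivity

theorem sum_le_poolWealth (ρ : ℝ≥0) {z : ℝ} (hz : 0 ≤ z) (x : Fin N → ℝ≥0) :
    ∑ n, (x n : ℝ) ≤ poolWealth ρ z x :=
  le_add_of_nonneg_left (mul_nonneg hz ρ.2)

theorem div_poolWealth_le_one (ρ : ℝ≥0) {z : ℝ} (hz : 0 ≤ z) (x : Fin N → ℝ≥0) (n : Fin N) :
    x n / poolWealth ρ z x ≤ 1 :=
  div_le_one_of_le₀ ((Finset.single_le_sum (f := fun k => (x k : ℝ)) (fun k _ => (x k).2)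
    (Finset.mem_univ n)).trans (sum_le_poolWealth ρ hz x)) (poolWealth_nonneg ρ hz x)

/-- The expected return `∫ c ρ / (ζ ρ + |x|) κ(dx)` of the bank account relative to the growth of
the pooled wealth from `c` to `ζ ρ + |x|`. It is `cashIntegral κ ρ c ζ` as a real number. -/
def cashReturn (κ : Measure (Fin N → ℝ≥0)) [IsProbabilityMeasure κ] (ρ : ℝ≥0) (c : ℝ) : ℝ :=
  ∫ x, c * ρ / poolWealth ρ (zeta κ ρ c) x ∂κ

variable (κ : Measure (Fin N → ℝ≥0)) [IsProbabilityMeasure κ] {ρ : ℝ≥0} {c z : ℝ}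

theorem zeta_eq_zero (h : ¬ InGamma κ ρ c) : zeta κ ρ c = 0 := by
  rw [zeta, dif_neg h]

theorem ae_poolWealth_zeta_pos (hc : 0 < c) (hpos : ∀ᵐ x ∂κ, 0 < ρ + ∑ n, x n) :
    ∀ᵐ x ∂κ, 0 < poolWealth ρ (zeta κ ρ c) x := by
  by_cases h : InGamma κ ρ c
  · have hζρ : 0 < zeta κ ρ c * ρ := mul_pos (zeta_spec κ h).1.1 (NNReal.coe_pos.2 h.pos.2)
    exact Eventually.of_forall fun x => add_pos_of_pos_of_nonneg hζρ (by positivity)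
  rw [zeta_eq_zero κ h]
  rcases eq_or_ne ρ 0 with rfl | hρ
  · filter_upwards [hpos] with x hx
    simpa [poolWealth] using NNReal.coe_pos.2 hx
  have hcρ : ENNReal.ofReal (c * ρ) ≠ 0 := by
    simpa using mul_pos hc (NNReal.coe_pos.2 (pos_iff_ne_zero.2 hρ))
  have hfin : cashIntegral κ ρ c 0 ≠ ∞ := ne_top_of_le_ne_top ENNReal.one_ne_top (not_lt.1 h)
  filter_upwards [ae_lt_top (measurable_cashIntegrand ρ c 0) hfin] with x hx
  by_contra hpool
  rw [poolWealth] at hpool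
  rw [ENNReal.ofReal_of_nonpos (not_lt.1 hpool), ENNReal.div_zero hcρ] at hx
  exact hx.ne rfl

theorem cashIntegral_zeta_le_one (ρ : ℝ≥0) (c : ℝ) : cashIntegral κ ρ c (zeta κ ρ c) ≤ 1 := by
  by_cases h : InGamma κ ρ c
  · exact (zeta_spec κ h).2.le
  · rw [zeta_eq_zero κ h]
    exact not_lt.1 h

theorem lintegral_cash_div_poolWealth (hc : 0 < c) (hpos : ∀ᵐ x ∂κ, 0 < ρ + ∑ n, x n) :
    ∫⁻ x, ENNReal.ofReal (c * ρ / poolWealth ρ (zeta κ ρ c) x) ∂κ =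
      cashIntegral κ ρ c (zeta κ ρ c) := by
  refine lintegral_congr_ae ?_
  filter_upwards [ae_poolWealth_zeta_pos κ hc hpos] with x hx
  exact ENNReal.ofReal_div_of_pos hx

theorem cash_div_poolWealth_nonneg (ρ : ℝ≥0) (hc : 0 ≤ c) (x : Fin N → ℝ≥0) :
    0 ≤ c * ρ / poolWealth ρ (zeta κ ρ c) x :=
  div_nonneg (mul_nonneg hc ρ.2) (poolWealth_nonneg ρ (zeta_nonneg κ ρ c) x)

theorem integrable_cash_div_poolWealth (hc : 0 < c) (hpos : ∀ᵐ x ∂κ, 0 < ρ + ∑ n, x n) :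
    Integrable (fun x => c * ρ / poolWealth ρ (zeta κ ρ c) x) κ := by
  refine ⟨Measurable.aestronglyMeasurable (by fun_prop), ?_⟩
  rw [hasFiniteIntegral_iff_ofReal (ae_of_all _ (cash_div_poolWealth_nonneg κ ρ hc.le)),
    lintegral_cash_div_poolWealth κ hc hpos]
  exact (cashIntegral_zeta_le_one κ ρ c).trans_lt ENNReal.one_lt_top

theorem cashReturn_eq_toReal (hc : 0 < c) (hpos : ∀ᵐ x ∂κ, 0 < ρ + ∑ n, x n) :
    cashReturn κ ρ c = (cashIntegral κ ρ c (zeta κ ρ c)).toReal := by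
  rw [cashReturn, integral_eq_lintegral_of_nonneg_ae
    (ae_of_all _ (cash_div_poolWealth_nonneg κ ρ hc.le))
    (integrable_cash_div_poolWealth κ hc hpos).1, lintegral_cash_div_poolWealth κ hc hpos]

theorem cashReturn_le_one (hc : 0 < c) (hpos : ∀ᵐ x ∂κ, 0 < ρ + ∑ n, x n) :
    cashReturn κ ρ c ≤ 1 := by
  rw [cashReturn_eq_toReal κ hc hpos]
  exact ENNReal.toReal_le_of_le_ofReal zero_le_one (by simpa using cashIntegral_zeta_le_one κ ρ c)

theorem zeta_mul_cashReturn (hc : 0 < c) (hpos : ∀ᵐ x ∂κ, 0 < ρ + ∑ n, x n) :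
    zeta κ ρ c * cashReturn κ ρ c = zeta κ ρ c := by
  by_cases h : InGamma κ ρ c
  · rw [cashReturn_eq_toReal κ hc hpos, (zeta_spec κ h).2, ENNReal.toReal_one, mul_one]
  · rw [zeta_eq_zero κ h, zero_mul]

theorem integrable_div_poolWealth (ρ : ℝ≥0) (hz : 0 ≤ z) (n : Fin N) :
    Integrable (fun x : Fin N → ℝ≥0 => x n / poolWealth ρ z x) κ := by
  refine Integrable.of_bound (C := 1) (Measurable.aestronglyMeasurable (by fun_prop))
    (ae_of_all _ fun x => ?_)
  rw [Real.norm_of_nonneg (div_nonneg (x n).coe_nonneg (poolWealth_nonneg ρ hz x))]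
  exact div_poolWealth_le_one ρ hz x n

theorem ae_eq_zero_of_optimalShare_eq_zero (hz : 0 ≤ z) (hpool : ∀ᵐ x ∂κ, 0 < poolWealth ρ z x)
    {n : Fin N} (h : optimalShare κ ρ z n = 0) : ∀ᵐ x ∂κ, x n = 0 := by
  have hint : ∀ᵐ x ∂κ, (x n : ℝ) / poolWealth ρ z x = 0 :=
    (integral_eq_zero_iff_of_nonneg
      (fun x => div_nonneg (x n).coe_nonneg (poolWealth_nonneg ρ hz x))
      (integrable_div_poolWealth κ ρ hz n)).1 h
  filter_upwards [hint, hpool] with x hx hx_pos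
  exact_mod_cast (div_eq_zero_iff.1 hx).resolve_right hx_pos.ne'

theorem one_sub_sum_optimalShare (hz : 0 ≤ z) (hpool : ∀ᵐ x ∂κ, 0 < poolWealth ρ z x) :
    1 - ∑ n, optimalShare κ ρ z n = ∫ x, z * ρ / poolWealth ρ z x ∂κ := by
  have hint := fun n => integrable_div_poolWealth κ ρ hz n
  calc 1 - ∑ n, optimalShare κ ρ z n
      = ∫ x, (1 - ∑ n, x n / poolWealth ρ z x) ∂κ := by
        rw [integral_sub (integrable_const _) (integrable_finsetSum _ fun n _ => hint n),
          integral_finsetSum _ fun n _ => hint n]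
        simp [optimalShare, poolWealth]
    _ = ∫ x, z * ρ / poolWealth ρ z x ∂κ := by
        refine integral_congr_ae ?_
        filter_upwards [hpool] with x hx
        rw [← Finset.sum_div, one_sub_div hx.ne', poolWealth, add_sub_cancel_right]

theorem zeta_eq_mul_one_sub_sum_optimalShare (hc : 0 < c) (hpos : ∀ᵐ x ∂κ, 0 < ρ + ∑ n, x n) :
    zeta κ ρ c = c * (1 - ∑ n, optimalShare κ ρ (zeta κ ρ c) n) := by
  rw [one_sub_sum_optimalShare κ (zeta_nonneg κ ρ c) (ae_poolWealth_zeta_pos κ hc hpos),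
    ← integral_const_mul]
  conv_lhs => rw [← zeta_mul_cashReturn κ hc hpos, cashReturn, ← integral_const_mul]
  congr with x
  ring

-- Complementary slackness: cash is held only if its expected relative return is `1`.
theorem one_sub_sum_optimalShare_mul_one_sub_cashReturn (hc : 0 < c)
    (hpos : ∀ᵐ x ∂κ, 0 < ρ + ∑ n, x n) :
    (1 - ∑ n, optimalShare κ ρ (zeta κ ρ c) n) * (1 - cashReturn κ ρ c) = 0 := by
  have hζ : zeta κ ρ c * (1 - cashReturn κ ρ c) = 0 := by
    rw [mul_sub, mul_one, zeta_mul_cashReturn κ hc hpos, sub_self]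
  rw [zeta_eq_mul_one_sub_sum_optimalShare κ hc hpos, mul_assoc] at hζ
  exact (mul_eq_zero.1 hζ).resolve_left hc.ne'

end Zeta

section WealthShare

variable {ι : Type*} [Fintype ι] {y : ι → ℝ}

/-- The relative wealth of investor `i` when the wealth of the investors is `y`, with
`0 / 0 = 0`. -/
def wealthShare (y : ι → ℝ) (i : ι) : ℝ :=
  y i / ∑ k, y k

theorem sum_pos_of_nonneg_of_pos (hy : ∀ k, 0 ≤ y k) {i : ι} (hi : 0 < y i) : 0 < ∑ k, y k :=
  Finset.sum_pos' (fun k _ => hy k) ⟨i, Finset.mem_univ i, hi⟩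

theorem wealthShare_nonneg (hy : ∀ k, 0 ≤ y k) (i : ι) : 0 ≤ wealthShare y i :=
  div_nonneg (hy i) (Finset.sum_nonneg fun k _ => hy k)

theorem wealthShare_pos (hy : ∀ k, 0 ≤ y k) {i : ι} (hi : 0 < y i) : 0 < wealthShare y i :=
  div_pos hi (sum_pos_of_nonneg_of_pos hy hi)

theorem wealthShare_le_one (hy : ∀ k, 0 ≤ y k) (i : ι) : wealthShare y i ≤ 1 :=
  div_le_one_of_le₀ (Finset.single_le_sum (fun k _ => hy k) (Finset.mem_univ i))
    (Finset.sum_nonneg fun k _ => hy k)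

theorem sum_wealthShare_le_one (y : ι → ℝ) : ∑ k, wealthShare y k ≤ 1 := by
  simp only [wealthShare]
  rw [← Finset.sum_div]
  exact div_self_le_one _

end WealthShare

section Step

variable {M N : ℕ} {y : Fin M → ℝ}

/-- The proportion of the total wealth that all investors together invest in the asset `n`. -/
def meanProportion (l : Fin M → Proportions N) (y : Fin M → ℝ) (n : Fin N) : ℝ :=
  ∑ k, wealthShare y k * (l k).1 n

theorem meanProportion_nonneg (l : Fin M → Proportions N) (hy : ∀ k, 0 ≤ y k) (n : Fin N) :
    0 ≤ meanProportion l y n :=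
  Finset.sum_nonneg fun k _ => mul_nonneg (wealthShare_nonneg hy k) ((l k).2.1 n)

theorem sum_meanProportion_le_one (l : Fin M → Proportions N) (hy : ∀ k, 0 ≤ y k) :
    ∑ n, meanProportion l y n ≤ 1 := by
  calc ∑ n, meanProportion l y n = ∑ k, wealthShare y k * ∑ n, (l k).1 n := by
        simp only [meanProportion, Finset.mul_sum]
        exact Finset.sum_comm
    _ ≤ ∑ k, wealthShare y k :=
        Finset.sum_le_sum fun k _ => mul_le_of_le_one_right (wealthShare_nonneg hy k) (l k).2.2
    _ ≤ 1 := sum_wealthShare_le_one y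

theorem eq_zero_of_meanProportion_eq_zero {l : Fin M → Proportions N} (hy : ∀ k, 0 ≤ y k)
    {i : Fin M} (hi : 0 < y i) {n : Fin N} (h : meanProportion l y n = 0) : (l i).1 n = 0 := by
  have hterm := (Finset.sum_eq_zero_iff_of_nonneg fun k _ =>
    mul_nonneg (wealthShare_nonneg hy k) ((l k).2.1 n)).1 h i (Finset.mem_univ i)
  exact (mul_eq_zero.1 hterm).resolve_left (wealthShare_pos hy hi).ne'

theorem sub_meanProportion (l : Fin M → Proportions N) (hy : ∀ k, 0 ≤ y k) (i : Fin M)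
    (n : Fin N) :
    (l i).1 n - meanProportion l y n = (1 - wealthShare y i) * ((l i).1 n -
      ∑ k ∈ Finset.univ.erase i, wealthShare y k / (1 - wealthShare y i) * (l k).1 n) := by
  have hothers : ∀ k ∈ Finset.univ.erase i, (1 - wealthShare y i) *
      (wealthShare y k / (1 - wealthShare y i) * (l k).1 n) = wealthShare y k * (l k).1 n := by
    intro k hk
    rcases eq_or_ne (1 - wealthShare y i) 0 with h | h
    · have hle : wealthShare y k ≤ ∑ j ∈ Finset.univ.erase i, wealthShare y j :=
        Finset.single_le_sum (fun j _ => wealthShare_nonneg hy j) hk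
      have hsum := Finset.add_sum_erase Finset.univ (wealthShare y) (Finset.mem_univ i)
      have hk_zero : wealthShare y k = 0 := by
        linarith [wealthShare_nonneg hy k, sum_wealthShare_le_one y]
      simp [hk_zero]
    · rw [← mul_assoc, mul_div_cancel₀ _ h]
  rw [mul_sub, Finset.mul_sum, Finset.sum_congr rfl hothers, meanProportion,
    ← Finset.add_sum_erase _ _ (Finset.mem_univ i)]
  ring

theorem sum_mul_eq_sum_mul_meanProportion (l : Fin M → Proportions N) (hy : ∑ k, y k ≠ 0)
    (n : Fin N) : ∑ k, (l k).1 n * y k = (∑ k, y k) * meanProportion l y n := by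
  rw [meanProportion, Finset.mul_sum]
  refine Finset.sum_congr rfl fun k _ => ?_
  rw [wealthShare, ← mul_assoc, mul_div_cancel₀ _ hy, mul_comm]

theorem wealthStep_nonneg (ρ : ℝ≥0) (x : Fin N → ℝ≥0) (l : Fin M → Proportions N)
    (hy : ∀ k, 0 ≤ y k) (i : Fin M) : 0 ≤ wealthStep ρ x l y i := by
  have hcash : 0 ≤ 1 - ∑ n, (l i).1 n := sub_nonneg.2 (l i).2.2
  have hbid : ∀ k n, 0 ≤ (l k).1 n * y k := fun k n => mul_nonneg ((l k).2.1 n) (hy k)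
  exact add_nonneg (mul_nonneg (mul_nonneg ρ.2 hcash) (hy i)) (Finset.sum_nonneg fun n _ =>
    mul_nonneg (div_nonneg (hbid i n) (Finset.sum_nonneg fun k _ => hbid k n)) (x n).2)

theorem wealthStep_eq_wealthShare_mul (ρ : ℝ≥0) (x : Fin N → ℝ≥0) (l : Fin M → Proportions N)
    (hy : ∑ k, y k ≠ 0) (i : Fin M) :
    wealthStep ρ x l y i = wealthShare y i * ((∑ k, y k) * (1 - ∑ n, (l i).1 n) * ρ +
      ∑ n, x n * ((l i).1 n / meanProportion l y n)) := by
  rw [wealthStep, mul_add, Finset.mul_sum]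
  congr 1
  · rw [wealthShare]
    field_simp
  · refine Finset.sum_congr rfl fun n _ => ?_
    rw [sum_mul_eq_sum_mul_meanProportion l hy, mul_comm (∑ k, y k), mul_div_mul_comm,
      wealthShare]
    ring

theorem sum_wealthStep (ρ : ℝ≥0) {x : Fin N → ℝ≥0} {l : Fin M → Proportions N}
    (hy : ∑ k, y k ≠ 0) (hx : ∀ n, meanProportion l y n = 0 → x n = 0) :
    ∑ k, wealthStep ρ x l y k =
      poolWealth ρ ((∑ k, y k) * (1 - ∑ n, meanProportion l y n)) x := by
  have hmean : ∑ k, (∑ n, (l k).1 n) * y k = (∑ k, y k) * ∑ n, meanProportion l y n := by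
    simp only [Finset.sum_mul, Finset.mul_sum, ← sum_mul_eq_sum_mul_meanProportion l hy]
    exact Finset.sum_comm
  have hcash : ∑ k, (ρ : ℝ) * (1 - ∑ n, (l k).1 n) * y k =
      (∑ k, y k) * (1 - ∑ n, meanProportion l y n) * ρ := by
    calc ∑ k, (ρ : ℝ) * (1 - ∑ n, (l k).1 n) * y k
        = ρ * (∑ k, y k - ∑ k, (∑ n, (l k).1 n) * y k) := by
          rw [← Finset.sum_sub_distrib, Finset.mul_sum]
          exact Finset.sum_congr rfl fun k _ => by ring
      _ = _ := by rw [hmean]; ring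
  have hassets : ∑ k, ∑ n, (l k).1 n * y k / (∑ j, (l j).1 n * y j) * (x n : ℝ) =
      ∑ n, (x n : ℝ) := by
    rw [Finset.sum_comm]
    refine Finset.sum_congr rfl fun n _ => ?_
    rw [← Finset.sum_mul, ← Finset.sum_div, sum_mul_eq_sum_mul_meanProportion l hy]
    by_cases h : meanProportion l y n = 0
    · simp [hx n h]
    · rw [div_self (mul_ne_zero hy h), one_mul]
  simp only [wealthStep, Finset.sum_add_distrib, hcash, hassets, poolWealth]

theorem wealthStep_pos {ρ : ℝ≥0} {x : Fin N → ℝ≥0} {l : Fin M → Proportions N}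
    (hy : ∀ k, 0 ≤ y k) {i : Fin M} (hi : 0 < y i)
    (hpool : 0 < poolWealth ρ ((∑ k, y k) * (1 - ∑ n, (l i).1 n)) x)
    (hx : ∀ n, (l i).1 n = 0 → x n = 0) : 0 < wealthStep ρ x l y i := by
  have hc := sum_pos_of_nonneg_of_pos hy hi
  have hcash : 0 ≤ (∑ k, y k) * (1 - ∑ n, (l i).1 n) * ρ :=
    mul_nonneg (mul_nonneg hc.le (sub_nonneg.2 (l i).2.2)) ρ.2
  have hasset : ∀ n, 0 ≤ x n * ((l i).1 n / meanProportion l y n) := fun n =>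
    mul_nonneg (x n).2 (div_nonneg ((l i).2.1 n) (meanProportion_nonneg l hy n))
  rw [wealthStep_eq_wealthShare_mul ρ x l hc.ne']
  refine mul_pos (wealthShare_pos hy hi) ?_
  by_contra! hle
  have hcash_zero : (∑ k, y k) * (1 - ∑ n, (l i).1 n) * ρ = 0 := by
    linarith [Finset.sum_nonneg fun n (_ : n ∈ Finset.univ) => hasset n]
  rw [hcash_zero, zero_add] at hle
  have hx_zero : ∀ n, x n = 0 := by
    intro n
    have hn := (Finset.sum_eq_zero_iff_of_nonneg fun n _ => hasset n).1
      (hle.antisymm (Finset.sum_nonneg fun n _ => hasset n)) n (Finset.mem_univ n)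
    rcases mul_eq_zero.1 hn with h | h
    · exact_mod_cast h
    · exact hx n ((div_eq_zero_iff.1 h).elim id (eq_zero_of_meanProportion_eq_zero hy hi))
  simp [poolWealth, hcash_zero, hx_zero] at hpool

end Step

section LogGrowth

variable {M N : ℕ} {ρ : ℝ≥0} {x : Fin N → ℝ≥0} {l : Fin M → Proportions N} {y : Fin M → ℝ}
  {i : Fin M} {z : ℝ}

-- Jensen's inequality with the weights `x n / (z ρ + |x|)`.
theorem sum_mul_log_le_log_wealthStep_div (hy : ∀ k, 0 ≤ y k) (hi : 0 < y i)
    (hz : z = (∑ k, y k) * (1 - ∑ n, (l i).1 n)) (hpool : 0 < poolWealth ρ z x)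
    (hx : ∀ n, (l i).1 n = 0 → x n = 0) :
    ∑ n, x n / poolWealth ρ z x * Real.log ((l i).1 n / meanProportion l y n) ≤
      Real.log (wealthStep ρ x l y i / (wealthShare y i * poolWealth ρ z x)) := by
  have hc := sum_pos_of_nonneg_of_pos hy hi
  have hz_nonneg : 0 ≤ z := hz ▸ mul_nonneg hc.le (sub_nonneg.2 (l i).2.2)
  have hgrowth : wealthStep ρ x l y i / (wealthShare y i * poolWealth ρ z x) =
      1 + ∑ n, x n / poolWealth ρ z x * ((l i).1 n / meanProportion l y n - 1) := by
    rw [wealthStep_eq_wealthShare_mul ρ x l hc.ne', ← hz,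
      mul_div_mul_left _ _ (wealthShare_pos hy hi).ne', div_eq_iff hpool.ne', add_mul, one_mul,
      Finset.sum_mul]
    conv_rhs => rw [poolWealth, add_assoc, ← Finset.sum_add_distrib]
    refine congrArg _ (Finset.sum_congr rfl fun n _ => ?_)
    rw [← poolWealth]
    field_simp
    ring
  rw [hgrowth]
  refine sum_mul_log_le_log_one_add (fun n => div_nonneg (x n).2 hpool.le) ?_
    (fun n => div_nonneg ((l i).2.1 n) (meanProportion_nonneg l hy n)) fun n h => ?_
  · rw [← Finset.sum_div]
    exact div_le_one_of_le₀ (sum_le_poolWealth ρ hz_nonneg x) hpool.le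
  · rw [hx n ((div_eq_zero_iff.1 h).elim id (eq_zero_of_meanProportion_eq_zero hy hi)),
      NNReal.coe_zero, zero_div]

theorem log_sum_wealthStep_div_le (hy : ∀ k, 0 ≤ y k) (hi : 0 < y i)
    (hz : z = (∑ k, y k) * (1 - ∑ n, (l i).1 n)) (hpool : 0 < poolWealth ρ z x)
    (hx : ∀ n, (l i).1 n = 0 → x n = 0) :
    Real.log ((∑ k, wealthStep ρ x l y k) / poolWealth ρ z x) ≤
      (∑ n, (l i).1 n - ∑ n, meanProportion l y n) * ((∑ k, y k) * ρ / poolWealth ρ z x) := by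
  have hsum : 0 < ∑ k, wealthStep ρ x l y k :=
    sum_pos_of_nonneg_of_pos (wealthStep_nonneg ρ x l hy) (wealthStep_pos hy hi (hz ▸ hpool) hx)
  refine (Real.log_le_sub_one_of_pos (div_pos hsum hpool)).trans_eq ?_
  rw [sum_wealthStep ρ (sum_pos_of_nonneg_of_pos hy hi).ne'
    fun n h => hx n (eq_zero_of_meanProportion_eq_zero hy hi h), div_sub_one hpool.ne',
    ← mul_div_assoc]
  simp only [poolWealth, hz]
  ring

/-- A lower bound for the growth of the logarithm of the relative wealth of an investor with
proportions `a` when the investors together have wealth `c` and mean proportions `b`, where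
`z = c (1 - |a|)`. -/
def growthBound (ρ : ℝ≥0) (c z : ℝ) (a b : Fin N → ℝ) (x : Fin N → ℝ≥0) : ℝ :=
  ∑ n, x n / poolWealth ρ z x * Real.log (a n / b n) -
    (∑ n, a n - ∑ n, b n) * (c * ρ / poolWealth ρ z x)

theorem growthBound_le_log_sub_log (hy : ∀ k, 0 ≤ y k) (hi : 0 < y i)
    (hz : z = (∑ k, y k) * (1 - ∑ n, (l i).1 n)) (hpool : 0 < poolWealth ρ z x)
    (hx : ∀ n, (l i).1 n = 0 → x n = 0) :
    growthBound ρ (∑ k, y k) z (l i).1 (meanProportion l y) x ≤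
      Real.log (wealthShare (wealthStep ρ x l y) i) - Real.log (wealthShare y i) := by
  have hi' := wealthStep_pos hy hi (hz ▸ hpool) hx
  have hsum := sum_pos_of_nonneg_of_pos (wealthStep_nonneg ρ x l hy) hi'
  have hshare := wealthShare_pos hy hi
  have hlog : Real.log (wealthShare (wealthStep ρ x l y) i) - Real.log (wealthShare y i) =
      Real.log (wealthStep ρ x l y i / (wealthShare y i * poolWealth ρ z x)) -
        Real.log ((∑ k, wealthStep ρ x l y k) / poolWealth ρ z x) := by
    rw [wealthShare, Real.log_div hi'.ne' hsum.ne', Real.log_div hi'.ne' (by positivity),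
      Real.log_mul hshare.ne' hpool.ne', Real.log_div hsum.ne' hpool.ne']
    ring
  rw [hlog]
  exact sub_le_sub (sum_mul_log_le_log_wealthStep_div hy hi hz hpool hx)
    (log_sum_wealthStep_div_le hy hi hz hpool hx)

end LogGrowth

section ExpectedGrowth

variable {M N : ℕ} (κ : Measure (Fin N → ℝ≥0)) [IsProbabilityMeasure κ] {ρ : ℝ≥0} {c : ℝ}

theorem integrable_growthBound_zeta (hc : 0 < c) (hpos : ∀ᵐ x ∂κ, 0 < ρ + ∑ n, x n)
    (a b : Fin N → ℝ) : Integrable (growthBound ρ c (zeta κ ρ c) a b) κ :=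
  (integrable_finsetSum _ fun n _ =>
    (integrable_div_poolWealth κ ρ (zeta_nonneg κ ρ c) n).mul_const _).sub
      ((integrable_cash_div_poolWealth κ hc hpos).const_mul _)

theorem integral_growthBound_zeta (hc : 0 < c) (hpos : ∀ᵐ x ∂κ, 0 < ρ + ∑ n, x n)
    (a b : Fin N → ℝ) :
    ∫ x, growthBound ρ c (zeta κ ρ c) a b x ∂κ =
      ∑ n, optimalShare κ ρ (zeta κ ρ c) n * Real.log (a n / b n) -
        (∑ n, a n - ∑ n, b n) * cashReturn κ ρ c := by
  have hshare := fun n => (integrable_div_poolWealth κ ρ (zeta_nonneg κ ρ c) n).mul_const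
    (Real.log (a n / b n))
  simp only [growthBound]
  rw [integral_sub (integrable_finsetSum _ fun n _ => hshare n)
    ((integrable_cash_div_poolWealth κ hc hpos).const_mul _),
    integral_finsetSum _ fun n _ => hshare n, integral_const_mul]
  simp only [integral_mul_const]
  rfl

theorem sum_sq_sub_div_four_le_integral_growthBound (hc : 0 < c)
    (hpos : ∀ᵐ x ∂κ, 0 < ρ + ∑ n, x n) {a b : Fin N → ℝ}
    (ha : a = optimalShare κ ρ (zeta κ ρ c)) (hb : ∀ n, 0 ≤ b n) (hb₁ : ∑ n, b n ≤ 1)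
    (hab : ∀ n, b n = 0 → a n = 0) :
    ∑ n, (a n - b n) ^ 2 / 4 ≤ ∫ x, growthBound ρ c (zeta κ ρ c) a b x ∂κ := by
  have hζ := zeta_nonneg κ ρ c
  have ha_nonneg : ∀ n, 0 ≤ a n := ha ▸ optimalShare_nonneg κ ρ hζ
  have ha₁ : ∑ n, a n ≤ 1 := ha ▸ sum_optimalShare_le κ ρ hζ
  have hIcc : ∀ {w : Fin N → ℝ}, (∀ n, 0 ≤ w n) → ∑ n, w n ≤ 1 → ∀ n, w n ∈ Set.Icc 0 1 :=
    fun hw hw₁ n => ⟨hw n,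
      (Finset.single_le_sum (fun k _ => hw k) (Finset.mem_univ n)).trans hw₁⟩
  have hslack : (1 - ∑ n, a n) * (1 - cashReturn κ ρ c) = 0 :=
    ha ▸ one_sub_sum_optimalShare_mul_one_sub_cashReturn κ hc hpos
  have hcash : (∑ n, a n - ∑ n, b n) * cashReturn κ ρ c ≤ ∑ n, a n - ∑ n, b n := by
    have := mul_nonneg (sub_nonneg.2 hb₁) (sub_nonneg.2 (cashReturn_le_one κ hc hpos))
    linarith
  rw [integral_growthBound_zeta κ hc hpos, ← ha]
  linarith [sum_sq_sub_div_four_le_sum_mul_log (hIcc ha_nonneg ha₁) (hIcc hb hb₁) hab]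

variable {l : Fin M → Proportions N} {y : Fin M → ℝ} {i : Fin M}

theorem ae_wealthStep_pos_and_growthBound_le (hpos : ∀ᵐ x ∂κ, 0 < ρ + ∑ n, x n)
    (hy : ∀ k, 0 ≤ y k) (hi : 0 < y i)
    (hl : (l i).1 = optimalShare κ ρ (zeta κ ρ (∑ k, y k))) :
    ∀ᵐ x ∂κ, 0 < wealthStep ρ x l y i ∧
      growthBound ρ (∑ k, y k) (zeta κ ρ (∑ k, y k)) (l i).1 (meanProportion l y) x ≤
        Real.log (wealthShare (wealthStep ρ x l y) i) - Real.log (wealthShare y i) := by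
  have hc := sum_pos_of_nonneg_of_pos hy hi
  have hζ : zeta κ ρ (∑ k, y k) = (∑ k, y k) * (1 - ∑ n, (l i).1 n) := by
    rw [hl]
    exact zeta_eq_mul_one_sub_sum_optimalShare κ hc hpos
  have hpool := ae_poolWealth_zeta_pos κ hc hpos
  have hx : ∀ᵐ x ∂κ, ∀ n, (l i).1 n = 0 → x n = 0 := by
    refine ae_all_iff.2 fun n => Filter.eventually_imp_distrib_left.2 fun h => ?_
    exact ae_eq_zero_of_optimalShare_eq_zero κ (zeta_nonneg κ ρ _) hpool (hl ▸ h)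
  filter_upwards [hpool, hx] with x hpool_x hx_x
  exact ⟨wealthStep_pos hy hi (hζ ▸ hpool_x) hx_x,
    growthBound_le_log_sub_log hy hi hζ hpool_x hx_x⟩

theorem lintegral_neg_log_wealthShare_wealthStep_add_le (hpos : ∀ᵐ x ∂κ, 0 < ρ + ∑ n, x n)
    (hy : ∀ k, 0 ≤ y k) (hi : 0 < y i)
    (hl : (l i).1 = optimalShare κ ρ (zeta κ ρ (∑ k, y k))) :
    ∫⁻ x, ENNReal.ofReal (-Real.log (wealthShare (wealthStep ρ x l y) i)) ∂κ +
        ENNReal.ofReal (∑ n, ((l i).1 n - meanProportion l y n) ^ 2 / 4) ≤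
      ENNReal.ofReal (-Real.log (wealthShare y i)) := by
  have hc := sum_pos_of_nonneg_of_pos hy hi
  set G := growthBound ρ (∑ k, y k) (zeta κ ρ (∑ k, y k)) (l i).1 (meanProportion l y)
  have hG : Integrable G κ := integrable_growthBound_zeta κ hc hpos _ _
  have hstep : ∀ᵐ x ∂κ, 0 ≤ -Real.log (wealthShare (wealthStep ρ x l y) i) ∧
      -Real.log (wealthShare (wealthStep ρ x l y) i) ≤ -Real.log (wealthShare y i) - G x := by
    filter_upwards [ae_wealthStep_pos_and_growthBound_le κ hpos hy hi hl] with x hx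
    have hnext := wealthStep_nonneg ρ x l hy
    exact ⟨neg_nonneg.2 (Real.log_nonpos (wealthShare_nonneg hnext i)
      (wealthShare_le_one hnext i)), by linarith [hx.2]⟩
  have hbound : Integrable (fun x => -Real.log (wealthShare y i) - G x) κ :=
    (integrable_const _).sub hG
  have hbound_nonneg : 0 ≤ᵐ[κ] fun x => -Real.log (wealthShare y i) - G x :=
    hstep.mono fun x hx => hx.1.trans hx.2
  calc _ ≤ ∫⁻ x, ENNReal.ofReal (-Real.log (wealthShare y i) - G x) ∂κ +
          ENNReal.ofReal (∑ n, ((l i).1 n - meanProportion l y n) ^ 2 / 4) := by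
        gcongr ?_ + _
        exact lintegral_mono_ae (hstep.mono fun x hx => ENNReal.ofReal_le_ofReal hx.2)
    _ = ENNReal.ofReal (-Real.log (wealthShare y i) - ∫ x, G x ∂κ +
          ∑ n, ((l i).1 n - meanProportion l y n) ^ 2 / 4) := by
        rw [← ofReal_integral_eq_lintegral_ofReal hbound hbound_nonneg,
          ← ENNReal.ofReal_add (integral_nonneg_of_ae hbound_nonneg)
            (Finset.sum_nonneg fun n _ => by positivity),
          integral_sub (integrable_const _) hG, integral_const, probReal_univ, one_smul]
    _ ≤ _ := by
        refine ENNReal.ofReal_le_ofReal ?_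
        linarith [sum_sq_sub_div_four_le_integral_growthBound κ hc hpos hl
          (meanProportion_nonneg l hy) (sum_meanProportion_le_one l hy)
          fun n => eq_zero_of_meanProportion_eq_zero hy hi]

end ExpectedGrowth

section Disintegration

variable {Ω E : Type*} {m mΩ : MeasurableSpace Ω} {mE : MeasurableSpace E} {P : Measure Ω}

theorem measurable_prodMk_of_le (hm : m ≤ mΩ) {X : Ω → E} (hX : Measurable X) :
    Measurable[mΩ, m.prod mE] fun ω => (ω, X ω) :=
  (measurable_id'' hm).prodMk hX

/-- `κ` is a regular conditional distribution of `X` with respect to the σ-algebra `m`. Here `m`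
is part of the type of `κ`, which makes `κ` measurable with respect to `m` everywhere. -/
structure IsRegularCondDistrib (κ : Kernel[m] Ω E) (X : Ω → E) (P : Measure Ω) : Prop where
  isProbabilityMeasure : ∀ ω, IsProbabilityMeasure (κ ω)
  real_ae_eq : ∀ B, MeasurableSet B → (fun ω => (κ ω).real B) =ᵐ[P] P⟦X ⁻¹' B | m⟧

namespace IsRegularCondDistrib

variable [IsFiniteMeasure P] {κ : Kernel[m] Ω E} {X : Ω → E}

theorem setLIntegral_apply (h : IsRegularCondDistrib κ X P) (hm : m ≤ mΩ) (hX : Measurable X)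
    {A : Set Ω} (hA : MeasurableSet[m] A) {B : Set E} (hB : MeasurableSet B) :
    ∫⁻ ω in A, κ ω B ∂P = P (A ∩ X ⁻¹' B) := by
  have := h.isProbabilityMeasure
  have hint : Integrable (fun ω => (κ ω).real B) (P.restrict A) :=
    Integrable.of_bound (C := 1)
      ((κ.measurable_coe hB).ennreal_toReal.mono hm le_rfl).aestronglyMeasurable
      (ae_of_all _ fun ω => by
        rw [Real.norm_of_nonneg measureReal_nonneg]
        exact measureReal_le_one)
  have hreal : ∫ ω in A, (κ ω).real B ∂P = P.real (A ∩ X ⁻¹' B) := by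
    rw [setIntegral_congr_ae (hm A hA) ((h.real_ae_eq B hB).mono fun ω hω _ => hω),
      setIntegral_condExp hm ((integrable_const _).indicator (hX hB)) hA,
      integral_indicator_const _ (hX hB), smul_eq_mul, mul_one,
      measureReal_restrict_apply (hX hB), Set.inter_comm]
  calc ∫⁻ ω in A, κ ω B ∂P = ∫⁻ ω in A, ENNReal.ofReal ((κ ω).real B) ∂P := by simp
    _ = P (A ∩ X ⁻¹' B) := by
        rw [← ofReal_integral_eq_lintegral_ofReal hint (ae_of_all _ fun ω => measureReal_nonneg),
          hreal, ofReal_measureReal]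

theorem trim_compProd_eq_map (h : IsRegularCondDistrib κ X P) (hm : m ≤ mΩ) (hX : Measurable X) :
    (P.trim hm) ⊗ₘ κ = @Measure.map Ω (Ω × E) mΩ (m.prod mE) (fun ω => (ω, X ω)) P := by
  have : IsMarkovKernel κ := ⟨h.isProbabilityMeasure⟩
  refine Measure.ext_prod fun {A B} hA hB => ?_
  rw [Measure.compProd_apply_prod hA hB, restrict_trim hm P hA,
    lintegral_trim hm (κ.measurable_coe hB), h.setLIntegral_apply hm hX hA hB,
    Measure.map_apply (measurable_prodMk_of_le hm hX) (hA.prod hB)]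
  rfl

theorem setLIntegral_comp (h : IsRegularCondDistrib κ X P) (hm : m ≤ mΩ) (hX : Measurable X)
    {f : Ω × E → ℝ≥0∞} (hf : Measurable[m.prod mE] f) {A : Set Ω} (hA : MeasurableSet[m] A) :
    ∫⁻ ω in A, f (ω, X ω) ∂P = ∫⁻ ω in A, ∫⁻ x, f (ω, x) ∂(κ ω) ∂P := by
  have : IsMarkovKernel κ := ⟨h.isProbabilityMeasure⟩
  calc ∫⁻ ω in A, f (ω, X ω) ∂P
      = ∫⁻ q in A ×ˢ Set.univ, f q ∂(P.trim hm ⊗ₘ κ) := by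
        rw [h.trim_compProd_eq_map hm hX, @setLIntegral_map Ω (Ω × E) mΩ (m.prod mE) P _ _ _
          (hA.prod .univ) hf (measurable_prodMk_of_le hm hX), Set.mk_preimage_prod]
        simp
    _ = ∫⁻ ω in A, ∫⁻ x, f (ω, x) ∂(κ ω) ∂P := by
        rw [Measure.setLIntegral_compProd hf hA .univ, restrict_trim hm P hA]
        simp only [Measure.restrict_univ]
        exact lintegral_trim hm hf.lintegral_kernel_prod_right'

theorem ae_comp_iff (h : IsRegularCondDistrib κ X P) (hm : m ≤ mΩ) (hX : Measurable X)
    {p : Ω × E → Prop} (hp : MeasurableSet[m.prod mE] {q | p q}) :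
    (∀ᵐ ω ∂P, p (ω, X ω)) ↔ ∀ᵐ ω ∂P, ∀ᵐ x ∂(κ ω), p (ω, x) := by
  have : IsMarkovKernel κ := ⟨h.isProbabilityMeasure⟩
  have hmeas : MeasurableSet[m] {ω | ∀ᵐ x ∂(κ ω), p (ω, x)} :=
    Kernel.measurable_kernel_prodMk_left (κ := κ) hp.compl (measurableSet_singleton 0)
  have hpair : @AEMeasurable Ω (Ω × E) (m.prod mE) mΩ (fun ω => (ω, X ω)) P :=
    @Measurable.aemeasurable Ω (Ω × E) mΩ (m.prod mE) _ P (measurable_prodMk_of_le hm hX)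
  rw [← @ae_map_iff Ω (Ω × E) mΩ (m.prod mE) P _ hpair _ hp,
    ← h.trim_compProd_eq_map hm hX, Measure.ae_compProd_iff hp]
  exact ⟨ae_of_ae_trim hm, fun h => (trim_measurableSet_eq hm hmeas.compl).trans h⟩

end IsRegularCondDistrib

end Disintegration

section Supermartingale

theorem tsum_le_of_succ_add_le {a b : ℕ → ℝ≥0∞} (h : ∀ t, a (t + 1) + b t ≤ a t) :
    ∑' t, b t ≤ a 0 := by
  suffices htel : ∀ t, a t + ∑ s ∈ Finset.range t, b s ≤ a 0 from
    ENNReal.tsum_le_of_sum_range_le fun t => le_add_self.trans (htel t)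
  intro t
  induction t with
  | zero => simp
  | succ t ih =>
    rw [Finset.sum_range_succ_comm, ← add_assoc]
    exact (add_le_add_left (h t) _).trans ih

variable {Ω : Type*} {mΩ : MeasurableSpace Ω} {P : Measure Ω} {ℱ : Filtration ℕ mΩ}
  {Z : ℕ → Ω → ℝ} {δ : ℕ → Ω → ℝ≥0∞}

theorem ae_tsum_lt_top_of_lintegral_add_le (hδ : ∀ t, Measurable (δ t))
    (hfin : ∫⁻ ω, ENNReal.ofReal (Z 0 ω) ∂P ≠ ∞)
    (hstep : ∀ t, ∫⁻ ω, ENNReal.ofReal (Z (t + 1) ω) ∂P + ∫⁻ ω, δ t ω ∂P ≤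
      ∫⁻ ω, ENNReal.ofReal (Z t ω) ∂P) :
    ∀ᵐ ω ∂P, ∑' t, δ t ω < ∞ := by
  refine ae_lt_top (Measurable.tsum hδ) ?_
  rw [lintegral_tsum fun t => (hδ t).aemeasurable]
  exact ne_top_of_le_ne_top hfin (tsum_le_of_succ_add_le hstep)

theorem supermartingale_of_setLIntegral_succ_le [IsFiniteMeasure P]
    (hZ : ∀ t, Measurable[ℱ t] (Z t)) (hZ_nonneg : ∀ t ω, 0 ≤ Z t ω)
    (hfin : ∫⁻ ω, ENNReal.ofReal (Z 0 ω) ∂P ≠ ∞)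
    (hstep : ∀ t A, MeasurableSet[ℱ t] A → ∫⁻ ω in A, ENNReal.ofReal (Z (t + 1) ω) ∂P ≤
      ∫⁻ ω in A, ENNReal.ofReal (Z t ω) ∂P) :
    Supermartingale Z ℱ P := by
  have hmeas : ∀ t, AEStronglyMeasurable (Z t) P := fun t =>
    ((hZ t).mono (ℱ.le t) le_rfl).aestronglyMeasurable
  have hanti : Antitone fun t => ∫⁻ ω, ENNReal.ofReal (Z t ω) ∂P :=
    antitone_nat_of_succ_le fun t => by simpa using hstep t Set.univ .univ
  have hfin_all : ∀ t, ∫⁻ ω, ENNReal.ofReal (Z t ω) ∂P ≠ ∞ := fun t =>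
    ne_top_of_le_ne_top hfin (hanti t.zero_le)
  refine supermartingale_of_setIntegral_succ_le (fun t => (hZ t).stronglyMeasurable)
    (fun t => ⟨hmeas t, ?_⟩) fun t A hA => ?_
  · rw [hasFiniteIntegral_iff_ofReal (ae_of_all _ (hZ_nonneg t))]
    exact (hfin_all t).lt_top
  · rw [integral_eq_lintegral_of_nonneg_ae (ae_of_all _ (hZ_nonneg _)) (hmeas _).restrict,
      integral_eq_lintegral_of_nonneg_ae (ae_of_all _ (hZ_nonneg _)) (hmeas _).restrict]
    exact ENNReal.toReal_mono
      (ne_top_of_le_ne_top (hfin_all t) (setLIntegral_le_lintegral _ _)) (hstep t A hA)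

theorem ae_exists_tendsto_of_supermartingale_of_nonneg [IsFiniteMeasure P]
    (hZ : Supermartingale Z ℱ P) (hZ_nonneg : ∀ t ω, 0 ≤ Z t ω) :
    ∀ᵐ ω ∂P, ∃ z, Tendsto (fun t => Z t ω) atTop (𝓝 z) := by
  have hbdd : ∀ t, eLpNorm ((-Z) t) 1 P ≤ (∫ ω, Z 0 ω ∂P).toNNReal := by
    intro t
    rw [Pi.neg_apply, eLpNorm_neg, eLpNorm_one_eq_lintegral_enorm,
      lintegral_congr fun ω => Real.enorm_of_nonneg (hZ_nonneg t ω),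
      ← ofReal_integral_eq_lintegral_ofReal (hZ.integrable t) (ae_of_all _ (hZ_nonneg t))]
    refine ENNReal.ofReal_le_ofReal ?_
    simpa using hZ.setIntegral_le t.zero_le (MeasurableSet.univ (m := ℱ 0))
  filter_upwards [hZ.neg.exists_ae_tendsto_of_bdd hbdd] with ω ⟨z, hz⟩
  exact ⟨-z, by simpa using hz.neg⟩

end Supermartingale

section Measurability

variable {A : Type*} [MeasurableSpace A] {M N : ℕ}

theorem measurable_proportion {l : A → Fin M → Proportions N} (hl : Measurable l) (k : Fin M)
    (n : Fin N) : Measurable fun a => (l a k).1 n :=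
  measurable_pi_iff.1 (measurable_subtype_coe.comp (measurable_pi_iff.1 hl k)) n

theorem measurable_wealthShare {y : A → Fin M → ℝ} (hy : Measurable y) (i : Fin M) :
    Measurable fun a => wealthShare (y a) i :=
  (measurable_pi_iff.1 hy i).div (Finset.measurable_sum _ fun k _ => measurable_pi_iff.1 hy k)

theorem measurable_wealthStep {ρ : A → ℝ≥0} {x : A → Fin N → ℝ≥0}
    {l : A → Fin M → Proportions N} {y : A → Fin M → ℝ} (hρ : Measurable ρ) (hx : Measurable x)
    (hl : Measurable l) (hy : Measurable y) :
    Measurable fun a => wealthStep (ρ a) (x a) (l a) (y a) := by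
  have hy' := measurable_pi_iff.1 hy
  have hl' := measurable_proportion hl
  unfold wealthStep
  fun_prop

end Measurability

section Realized

variable {Ω : Type*} {mΩ : MeasurableSpace Ω} {P : Measure Ω} {ℱ : Filtration ℕ mΩ} {M N : ℕ}

section Moves

variable (L : Fin M → Strategy ℱ M N) (y₀ : Fin M → ℝ≥0) (t : ℕ)

/-- The moves `λ_{t+1}(ω)` of all investors realized in the round `t + 1`, bundled so that they
can be fed to `wealthStep`. -/
def realizedMove (ω : Ω) : Fin M → Proportions N :=
  fun m => (L m).act t ω (y₀, realizedMoves L y₀ ω t)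

theorem measurable_realizedMove_of_measurable_realizedMoves
    (h : Measurable[ℱ t] fun ω => realizedMoves L y₀ ω t) :
    Measurable[ℱ t] (realizedMove L y₀ t) := by
  have hact := fun m => (L m).measurable_act t
  let _ : MeasurableSpace Ω := ℱ t
  exact measurable_pi_iff.2 fun m =>
    (hact m).comp (measurable_id.prodMk (measurable_const.prodMk h))

theorem measurable_realizedMoves : Measurable[ℱ t] fun ω => realizedMoves L y₀ ω t := by
  induction t with
  | zero => exact measurable_const
  | succ t ih =>
    have hlast : Measurable[ℱ (t + 1)] (realizedMove L y₀ t) :=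
      (measurable_realizedMove_of_measurable_realizedMoves L y₀ t ih).mono (ℱ.mono t.le_succ)
        le_rfl
    have hinit : Measurable[ℱ (t + 1)] fun ω => realizedMoves L y₀ ω t :=
      ih.mono (ℱ.mono t.le_succ) le_rfl
    refine @measurable_pi_iff _ _ _ (ℱ (t + 1)) _ _ |>.2 fun s => ?_
    induction s using Fin.lastCases with
    | last =>
      simp only [realizedMoves, Fin.snoc_last]
      exact hlast
    | cast s =>
      simpa only [realizedMoves, Fin.snoc_castSucc] using
        (@measurable_pi_iff _ _ _ (ℱ (t + 1)) _ _).1 hinit s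

theorem measurable_realizedMove : Measurable[ℱ t] (realizedMove L y₀ t) :=
  measurable_realizedMove_of_measurable_realizedMoves L y₀ t (measurable_realizedMoves L y₀ t)

end Moves

namespace Market

variable (S : Market P ℱ N) (L : Fin M → Strategy ℱ M N) (y₀ : Fin M → ℝ≥0) (t : ℕ)

theorem measurable_wealth : Measurable[ℱ t] (S.wealth L y₀ t) := by
  have hmoves := measurable_realizedMoves L y₀ t
  have hwealth := fun m => S.measurable_wealthOf (M := M) t m
  let _ : MeasurableSpace Ω := ℱ t
  exact measurable_pi_iff.2 fun m =>
    (hwealth m).comp (measurable_id.prodMk (measurable_const.prodMk hmoves))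

theorem measurable_relWealth (i : Fin M) : Measurable[ℱ t] fun ω => S.relWealth L y₀ t ω i :=
  @measurable_wealthShare Ω (ℱ t) _ _ (S.measurable_wealth L y₀ t) i

theorem measurable_distance (i : Fin M) : Measurable[ℱ t] (S.distance L y₀ i t) := by
  have hr := S.measurable_relWealth L y₀ t
  have hl := @measurable_proportion Ω (ℱ t) _ _ _ (measurable_realizedMove L y₀ t)
  let _ : MeasurableSpace Ω := ℱ t
  change ∀ k n, Measurable fun ω => realization L y₀ t ω k n at hl
  unfold distance representative
  simp only [EuclideanSpace.norm_eq]
  fun_prop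

theorem wealth_succ (ω : Ω) : S.wealth L y₀ (t + 1) ω =
    wealthStep (S.ρ (t + 1) ω) (S.X (t + 1) ω) (realizedMove L y₀ t ω) (S.wealth L y₀ t ω) := by
  funext m
  simp only [wealth, wealthOf, realizedMoves, Fin.snoc_last, Fin.init_snoc]
  rfl

theorem wealth_nonneg (ω : Ω) (m : Fin M) : 0 ≤ S.wealth L y₀ t ω m := by
  induction t generalizing m with
  | zero => exact (y₀ m).2
  | succ t ih =>
    rw [S.wealth_succ]
    exact wealthStep_nonneg _ _ _ ih m

theorem relWealth_nonneg (ω : Ω) (i : Fin M) : 0 ≤ S.relWealth L y₀ t ω i :=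
  wealthShare_nonneg (S.wealth_nonneg L y₀ t ω) i

theorem relWealth_le_one (ω : Ω) (i : Fin M) : S.relWealth L y₀ t ω i ≤ 1 :=
  wealthShare_le_one (S.wealth_nonneg L y₀ t ω) i

theorem neg_log_relWealth_nonneg (ω : Ω) (i : Fin M) :
    0 ≤ -Real.log (S.relWealth L y₀ t ω i) :=
  neg_nonneg.2 (Real.log_nonpos (S.relWealth_nonneg L y₀ t ω i) (S.relWealth_le_one L y₀ t ω i))

/-- `‖λ_{t+1}^i - λ̄_{t+1}‖² / 4`, where `λ̄` is the `meanProportion` of all investors. This bounds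
the expected growth of `log r^i` from below. It is encoded through
`λ^i - λ̄ = (1 - r^i) (λ^i - λ̃)`, where `λ̃` is the representative strategy of the others. -/
def growthGap (i : Fin M) (ω : Ω) : ℝ :=
  (1 - S.relWealth L y₀ t ω i) ^ 2 / 4 * S.distance L y₀ i t ω ^ 2

theorem measurable_growthGap (i : Fin M) : Measurable (S.growthGap L y₀ t i) := by
  have hr := (S.measurable_relWealth L y₀ t i).mono (ℱ.le t) le_rfl
  have hd := (S.measurable_distance L y₀ t i).mono (ℱ.le t) le_rfl
  unfold growthGap
  fun_prop

theorem growthGap_eq_sum (i : Fin M) (ω : Ω) : S.growthGap L y₀ t i ω =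
    ∑ n, ((realizedMove L y₀ t ω i).1 n -
      meanProportion (realizedMove L y₀ t ω) (S.wealth L y₀ t ω) n) ^ 2 / 4 := by
  rw [growthGap, distance, EuclideanSpace.norm_sq_eq, Finset.mul_sum]
  refine Finset.sum_congr rfl fun n _ => ?_
  rw [sub_meanProportion _ (S.wealth_nonneg L y₀ t ω), mul_pow, mul_div_right_comm,
    Real.norm_eq_abs, sq_abs]
  rfl

end Market

end Realized

section Growth

variable {Ω : Type*} {mΩ : MeasurableSpace Ω} {P : Measure Ω} {ℱ : Filtration ℕ mΩ} {M N : ℕ}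
  {S : Market P ℱ N}

namespace PayoffKernel

theorem isRegularCondDistrib (K : PayoffKernel S) (t : ℕ) :
    IsRegularCondDistrib (K.kernel t) (S.X (t + 1)) P :=
  ⟨K.prob t, K.version t⟩

variable [IsFiniteMeasure P] (K : PayoffKernel S)

theorem setLIntegral_comp (t : ℕ) {f : Ω × (Fin N → ℝ≥0) → ℝ≥0∞}
    (hf : Measurable[(ℱ t).prod inferInstance] f) {A : Set Ω} (hA : MeasurableSet[ℱ t] A) :
    ∫⁻ ω in A, f (ω, S.X (t + 1) ω) ∂P = ∫⁻ ω in A, ∫⁻ x, f (ω, x) ∂(K.kernel t ω) ∂P :=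
  (K.isRegularCondDistrib t).setLIntegral_comp (ℱ.le t)
    ((S.measurable_X t).mono (ℱ.le _) le_rfl) hf hA

theorem ae_comp_iff (t : ℕ) {p : Ω × (Fin N → ℝ≥0) → Prop}
    (hp : MeasurableSet[(ℱ t).prod inferInstance] {q | p q}) :
    (∀ᵐ ω ∂P, p (ω, S.X (t + 1) ω)) ↔ ∀ᵐ ω ∂P, ∀ᵐ x ∂(K.kernel t ω), p (ω, x) :=
  (K.isRegularCondDistrib t).ae_comp_iff (ℱ.le t) ((S.measurable_X t).mono (ℱ.le _) le_rfl) hp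

theorem ae_payoff_pos (t : ℕ) :
    ∀ᵐ ω ∂P, ∀ᵐ x ∂(K.kernel t ω), 0 < S.ρ (t + 1) ω + ∑ n, x n := by
  refine (K.ae_comp_iff t (p := fun q => 0 < S.ρ (t + 1) q.1 + ∑ n, q.2 n) ?_).1 (S.pos t)
  have hρ := S.measurable_ρ t
  let _ : MeasurableSpace Ω := ℱ t
  exact measurableSet_lt measurable_const (by fun_prop)

end PayoffKernel

namespace Market

theorem measurable_wealthStep_prod (S : Market P ℱ N) (L : Fin M → Strategy ℱ M N)
    (y₀ : Fin M → ℝ≥0) (t : ℕ) :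
    Measurable[(ℱ t).prod inferInstance] fun q : Ω × (Fin N → ℝ≥0) =>
      wealthStep (S.ρ (t + 1) q.1) q.2 (realizedMove L y₀ t q.1) (S.wealth L y₀ t q.1) := by
  have hρ := S.measurable_ρ t
  have hl := measurable_realizedMove L y₀ t
  have hy := S.measurable_wealth L y₀ t
  let _ : MeasurableSpace Ω := ℱ t
  exact measurable_wealthStep (hρ.comp measurable_fst) measurable_snd (hl.comp measurable_fst)
    (hy.comp measurable_fst)

theorem realizedMove_eq_optimalShare {K : PayoffKernel S} {L : Fin M → Strategy ℱ M N}
    {y₀ : Fin M → ℝ≥0} {i : Fin M} (hL : L i = optimalStrategy M S K) (t : ℕ) (ω : Ω)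
    [IsProbabilityMeasure (K.kernel t ω)] :
    (realizedMove L y₀ t ω i).1 = optimalShare (K.kernel t ω) (S.ρ (t + 1) ω)
      (zeta (K.kernel t ω) (S.ρ (t + 1) ω) (∑ k, S.wealth L y₀ t ω k)) := by
  simp only [realizedMove, hL]
  rfl

variable [IsFiniteMeasure P] {K : PayoffKernel S} {L : Fin M → Strategy ℱ M N}
  {y₀ : Fin M → ℝ≥0} {i : Fin M}

theorem ae_wealth_pos (hL : L i = optimalStrategy M S K) (hy₀ : 0 < y₀ i) (t : ℕ) :
    ∀ᵐ ω ∂P, 0 < S.wealth L y₀ t ω i := by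
  induction t with
  | zero => exact ae_of_all _ fun _ => NNReal.coe_pos.2 hy₀
  | succ t ih =>
    simp only [S.wealth_succ]
    have hmeas := @measurable_pi_iff _ _ _ ((ℱ t).prod inferInstance) _ _ |>.1
      (S.measurable_wealthStep_prod L y₀ t) i
    refine (K.ae_comp_iff t (p := fun q => 0 < wealthStep (S.ρ (t + 1) q.1) q.2
      (realizedMove L y₀ t q.1) (S.wealth L y₀ t q.1) i) (hmeas measurableSet_Ioi)).2 ?_
    filter_upwards [ih, K.ae_payoff_pos t] with ω hω hpos
    have := K.prob t ω
    exact (ae_wealthStep_pos_and_growthBound_le _ hpos (S.wealth_nonneg L y₀ t ω) hω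
      (realizedMove_eq_optimalShare hL t ω)).mono fun x hx => hx.1

theorem ae_relWealth_pos (hL : L i = optimalStrategy M S K) (hy₀ : 0 < y₀ i) (t : ℕ) :
    ∀ᵐ ω ∂P, 0 < S.relWealth L y₀ t ω i :=
  (ae_wealth_pos hL hy₀ t).mono fun ω => wealthShare_pos (S.wealth_nonneg L y₀ t ω)

theorem ae_lintegral_neg_log_relWealth_add_le (hL : L i = optimalStrategy M S K)
    (hy₀ : 0 < y₀ i) (t : ℕ) : ∀ᵐ ω ∂P,
      ∫⁻ x, ENNReal.ofReal (-Real.log (wealthShare (wealthStep (S.ρ (t + 1) ω) x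
          (realizedMove L y₀ t ω) (S.wealth L y₀ t ω)) i)) ∂(K.kernel t ω) +
        ENNReal.ofReal (S.growthGap L y₀ t i ω) ≤
      ENNReal.ofReal (-Real.log (S.relWealth L y₀ t ω i)) := by
  filter_upwards [ae_wealth_pos hL hy₀ t, K.ae_payoff_pos t] with ω hω hpos
  have := K.prob t ω
  rw [growthGap_eq_sum]
  exact lintegral_neg_log_wealthShare_wealthStep_add_le _ hpos (S.wealth_nonneg L y₀ t ω) hω
    (realizedMove_eq_optimalShare hL t ω)

theorem setLIntegral_neg_log_relWealth_succ_add_le (hL : L i = optimalStrategy M S K)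
    (hy₀ : 0 < y₀ i) (t : ℕ) {A : Set Ω} (hA : MeasurableSet[ℱ t] A) :
    ∫⁻ ω in A, ENNReal.ofReal (-Real.log (S.relWealth L y₀ (t + 1) ω i)) ∂P +
      ∫⁻ ω in A, ENNReal.ofReal (S.growthGap L y₀ t i ω) ∂P ≤
      ∫⁻ ω in A, ENNReal.ofReal (-Real.log (S.relWealth L y₀ t ω i)) ∂P := by
  set f : Ω × (Fin N → ℝ≥0) → ℝ≥0∞ := fun q => ENNReal.ofReal (-Real.log (wealthShare
    (wealthStep (S.ρ (t + 1) q.1) q.2 (realizedMove L y₀ t q.1) (S.wealth L y₀ t q.1)) i))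
  have hf : Measurable[(ℱ t).prod inferInstance] f :=
    (Real.measurable_log.comp (@measurable_wealthShare _ ((ℱ t).prod inferInstance) _ _
      (S.measurable_wealthStep_prod L y₀ t) i)).neg.ennreal_ofReal
  calc _ = ∫⁻ ω in A, f (ω, S.X (t + 1) ω) ∂P +
          ∫⁻ ω in A, ENNReal.ofReal (S.growthGap L y₀ t i ω) ∂P := by
        simp only [relWealth, S.wealth_succ]
        rfl
    _ = ∫⁻ ω in A, (∫⁻ x, f (ω, x) ∂(K.kernel t ω) +
          ENNReal.ofReal (S.growthGap L y₀ t i ω)) ∂P := by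
        rw [K.setLIntegral_comp t hf hA,
          lintegral_add_right _ (S.measurable_growthGap L y₀ t i).ennreal_ofReal]
    _ ≤ _ := lintegral_mono_ae
        (ae_restrict_of_ae (ae_lintegral_neg_log_relWealth_add_le hL hy₀ t))

theorem lintegral_neg_log_relWealth_zero_ne_top (S : Market P ℱ N) (L : Fin M → Strategy ℱ M N)
    (y₀ : Fin M → ℝ≥0) (i : Fin M) :
    ∫⁻ ω, ENNReal.ofReal (-Real.log (S.relWealth L y₀ 0 ω i)) ∂P ≠ ∞ := by
  change ∫⁻ _, ENNReal.ofReal (-Real.log (wealthShare (fun k => (y₀ k : ℝ)) i)) ∂P ≠ ∞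
  rw [lintegral_const]
  exact ENNReal.mul_ne_top ENNReal.ofReal_ne_top (measure_ne_top P _)

theorem ae_exists_tendsto_relWealth (hL : L i = optimalStrategy M S K) (hy₀ : 0 < y₀ i) :
    ∀ᵐ ω ∂P, ∃ r, Tendsto (fun t => S.relWealth L y₀ t ω i) atTop (𝓝 r) := by
  have hsuper : Supermartingale (fun t ω => -Real.log (S.relWealth L y₀ t ω i)) ℱ P :=
    supermartingale_of_setLIntegral_succ_le
      (fun t => (Real.measurable_log.comp (S.measurable_relWealth L y₀ t i)).neg)
      (fun t ω => S.neg_log_relWealth_nonneg L y₀ t ω i)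
      (lintegral_neg_log_relWealth_zero_ne_top S L y₀ i)
      fun t A hA => le_self_add.trans (setLIntegral_neg_log_relWealth_succ_add_le hL hy₀ t hA)
  filter_upwards [ae_exists_tendsto_of_supermartingale_of_nonneg hsuper
      fun t ω => S.neg_log_relWealth_nonneg L y₀ t ω i,
    ae_all_iff.2 (ae_relWealth_pos hL hy₀)] with ω ⟨z, hz⟩ hpos
  refine ⟨Real.exp (-z), (Real.continuous_exp.tendsto _ |>.comp hz.neg).congr fun t => ?_⟩
  rw [Function.comp_apply, neg_neg, Real.exp_log (hpos t)]

theorem ae_summable_growthGap (hL : L i = optimalStrategy M S K) (hy₀ : 0 < y₀ i) :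
    ∀ᵐ ω ∂P, Summable fun t => S.growthGap L y₀ t i ω := by
  have hsum : ∀ᵐ ω ∂P, ∑' t, ENNReal.ofReal (S.growthGap L y₀ t i ω) < ∞ :=
    ae_tsum_lt_top_of_lintegral_add_le
      (Z := fun t ω => -Real.log (S.relWealth L y₀ t ω i))
      (fun t => (S.measurable_growthGap L y₀ t i).ennreal_ofReal)
      (lintegral_neg_log_relWealth_zero_ne_top S L y₀ i) fun t => by
        simpa using setLIntegral_neg_log_relWealth_succ_add_le hL hy₀ t .univ
  filter_upwards [hsum] with ω hω
  refine (ENNReal.summable_toReal hω.ne).congr fun t => ENNReal.toReal_ofReal ?_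
  unfold growthGap
  positivity

end Market

end Growth

section Limit

variable {Ω : Type*} {mΩ : MeasurableSpace Ω} {P : Measure Ω} {ℱ : Filtration ℕ mΩ} {M N : ℕ}

theorem summable_of_summable_mul_of_tendsto {w f : ℕ → ℝ} {a : ℝ} (hw : Tendsto w atTop (𝓝 a))
    (ha : a ≠ 0) (h : Summable fun t => w t * f t) : Summable f := by
  refine summable_of_isBigO_nat h ?_
  have hinv : (fun t => (w t)⁻¹) =O[atTop] fun _ => (1 : ℝ) := (hw.inv₀ ha).isBigO_one ℝ
  refine ((hinv.mul (Asymptotics.isBigO_refl (fun t => w t * f t) atTop)).congr' ?_ ?_)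
  · filter_upwards [hw.eventually_ne ha] with t ht using inv_mul_cancel_left₀ ht _
  · exact .of_forall fun t => one_mul _

namespace Market

theorem measurableSet_tsum_distance_sq_eq_top (S : Market P ℱ N) (L : Fin M → Strategy ℱ M N)
    (y₀ : Fin M → ℝ≥0) (i : Fin M) :
    MeasurableSet {ω | ∑' t, ENNReal.ofReal (S.distance L y₀ i t ω ^ 2) = ∞} :=
  Measurable.tsum (fun t => (((S.measurable_distance L y₀ t i).mono (ℱ.le t) le_rfl).pow_const
    2).ennreal_ofReal) (measurableSet_singleton ∞)

theorem ae_exists_tendsto_relWealth_and_summable_distance_sq [IsFiniteMeasure P]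
    {S : Market P ℱ N} {K : PayoffKernel S} {L : Fin M → Strategy ℱ M N} {y₀ : Fin M → ℝ≥0}
    {i : Fin M} (hL : L i = optimalStrategy M S K) (hy₀ : 0 < y₀ i) :
    ∀ᵐ ω ∂P, ∃ r ≤ 1, Tendsto (fun t => S.relWealth L y₀ t ω i) atTop (𝓝 r) ∧
      (r < 1 → Summable fun t => S.distance L y₀ i t ω ^ 2) := by
  filter_upwards [ae_exists_tendsto_relWealth hL hy₀, ae_summable_growthGap hL hy₀]
    with ω ⟨r, hr⟩ hsum
  refine ⟨r, le_of_tendsto' hr fun t => S.relWealth_le_one L y₀ t ω i, hr, fun hlt => ?_⟩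
  have hweight : Tendsto (fun t => (1 - S.relWealth L y₀ t ω i) ^ 2 / 4) atTop
      (𝓝 ((1 - r) ^ 2 / 4)) := ((hr.const_sub 1).pow 2).div_const 4
  exact summable_of_summable_mul_of_tendsto hweight
    (div_ne_zero (pow_ne_zero 2 (sub_ne_zero.2 hlt.ne')) four_ne_zero) hsum

end Market

end Limit

end AssetMarket

end

theorem theorem2 {Ω : Type*} {mΩ : MeasurableSpace Ω} (P : Measure Ω) [IsProbabilityMeasure P]
    (ℱ : Filtration ℕ mΩ) (M N : ℕ) (hM : 2 ≤ M) (hN : 1 ≤ N)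
    (S : AssetMarket.Market P ℱ N) (K : AssetMarket.PayoffKernel S)
    (y₀ : Fin M → ℝ≥0) (hy₀ : ∀ m, 0 < y₀ m)
    (L : Fin M → AssetMarket.Strategy ℱ M N)
    (hL : L ⟨0, by omega⟩ = AssetMarket.optimalStrategy M S K) :
    MeasurableSet {ω | ∑' t, ENNReal.ofReal (S.distance L y₀ ⟨0, by omega⟩ t ω ^ 2) = ∞} ∧
    (∀ᵐ ω ∂P, ∑' t, ENNReal.ofReal (S.distance L y₀ ⟨0, by omega⟩ t ω ^ 2) = ∞ →
      Tendsto (fun t => S.relWealth L y₀ t ω ⟨0, by omega⟩) atTop (𝓝 1)) ∧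
    (∀ᵐ ω ∂P, ∃ r : ℝ, Tendsto (fun t => S.relWealth L y₀ t ω ⟨0, by omega⟩) atTop (𝓝 r) ∧
      (r < 1 → Tendsto (fun t => S.distance L y₀ ⟨0, by omega⟩ t ω) atTop (𝓝 0))) := by
  have hconv :=
    AssetMarket.Market.ae_exists_tendsto_relWealth_and_summable_distance_sq hL (hy₀ _)
  refine ⟨S.measurableSet_tsum_distance_sq_eq_top L y₀ _, ?_, ?_⟩
  · filter_upwards [hconv] with ω ⟨r, hr_le, hr, hsum⟩ htop
    rcases hr_le.lt_or_eq with hlt | rfl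
    · exact absurd htop (hsum hlt).tsum_ofReal_ne_top
    · exact hr
  · filter_upwards [hconv] with ω ⟨r, _, hr, hsum⟩
    refine ⟨r, hr, fun hlt => ?_⟩
    simpa [AssetMarket.Market.distance] using (hsum hlt).tendsto_atTop_zero.sqrt
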